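/- Work in $\mathbb R^3\times\mathbb R=\mathbb R^4$ with units in which the speed of light is $1$. Let $F\subset\mathbb R^3$ be compact, $t_0\in\mathbb R$, and let $r_2:\mathbb R\times F\to\mathbb R^3$ be a *flow of matter*: $r_2$ is infinitely differentiable in $t$; $r_2$ and all its $t$-derivatives are continuous on $\mathbb R\times F$; for every $t_1$ there is $v_1<1$ with $|\partial_t r_2(t,r_0)|\le v_1$ for all $t\le t_1$, $r_0\in F$; for every $t$ the map $r_0\mapsto r_2(t,r_0)$ is one-to-one; and $r_2(t_0,r_0)=r_0$. Let $q$ be a finite signed Borel measure on $F$. For $(r_1,t)\in\mathbb R^3\times\mathbb R$ and $r_0\in F$ let $T=T(r_1,t,r_0)$ be the unique solution of $T=|r_1-r_2(t-T,r_0)|$, put $\tau=t-T$, $v=(\partial_t r_2)(\tau,r_0)$, and, where $T>0$, $$u=\frac1T,\qquad e=\frac{r_1-r_2(\tau,r_0)}{T},\qquad z=\frac1{1-\langle e,v\rangle}.$$ For a function $h(r_1,t,r_0)$ that for each $r_0\in F$ is locally integrable in $(r_1,t)\in\mathbb R^4$ (it may be undefined on the null set $T=0$), $\int_F h\,dq$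 denotes the distribution $g\mapsto\int_F\big(\int_{\mathbb R^4}h(x,r_0)\,g(x)\,dx\big)\,q(dr_0)$ on $\mathbb R^4$ (componentwise for vector-valued $h$). Being well defined includes that the inner integral is $|q|$-integrable in $r_0$ for every test function $g$, and that the resulting functional is a distribution. **Theorem.** The potentials $$\phi=\int_F uz\,dq,\qquad A=\int_F uzv\,dq$$ are well-defined distributions on $\mathbb R^4$. With $\Box=\nabla^2-\partial_t^2$, put $S=-\Box\phi$ and $J=-\Box A$ (the generalized charge and current densities), $E=-\nabla\phi-\partial_tA$ and $B=\nabla\times A$, all derivatives being distributional. Then Maxwell's equations $$\nabla\cdot E=S,\qquad \nabla\times E=-\partial_tB,\qquad \nabla\cdot B=0,\qquad \nabla\times B=\partial_tE+J$$ hold in the sense of distributions, and so does the equation of continuity $\nabla\cdot J+\partial_tS=0$. Moreover, where $T>0$ the functions $u^2e$, $e$ and $\partial_te$ are differentiable in $t$, and, with the derivatives inside the integrals taken pointwise there, $$E=\int_F\Big(u^2e+u^{-1}\partial_t(u^2e)+\partial_t^2e\Big)\,dq,\qquad B=\int_F e\times\Big(u^2e+u^{-1}\partial_t(u^2e)+\partial_t^2e\Big)\,dq,$$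 where both integrals are well defined. -/

import Mathlib

open MeasureTheory Set TopologicalSpace
open scoped Distributions ContDiff LineDeriv

noncomputable section

namespace MatterFlow

/-- Euclidean three-dimensional space. -/
abbrev Space : Type := EuclideanSpace ℝ (Fin 3)

/-- Points `(r₁, t)` of `R³ × R = R⁴`, with four-dimensional Lebesgue measure as `volume`. -/
abbrev SpaceTime : Type := Space × ℝ

/-! ### Flows of matter and their fundamental fields -/

/-- `r₂ : R × F → R³` is a flow of matter whose positions at time `t₀` fill the compact set `F`:
it is infinitely differentiable in `t`, it and all its `t`-derivatives are jointly continuous, on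
every half-line `t ≤ t₁` the speeds are bounded by a constant smaller than the speed of light `1`,
for every `t` the map `r₀ ↦ r₂(t, r₀)` is one-to-one, and `r₂(t₀, r₀) = r₀`. -/
structure IsFlowOfMatter (F : Set Space) (t₀ : ℝ) (r₂ : ℝ → F → Space) : Prop where
  isCompact : IsCompact F
  contDiff : ∀ r₀ : F, ContDiff ℝ ∞ fun t => r₂ t r₀
  continuous_iteratedDeriv : ∀ n : ℕ,
    Continuous fun p : ℝ × F => iteratedDeriv n (fun t => r₂ t p.2) p.1
  speed_le : ∀ t₁ : ℝ, ∃ v₁ : ℝ, v₁ < 1 ∧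
    ∀ t ≤ t₁, ∀ r₀ : F, ‖deriv (fun s => r₂ s r₀) t‖ ≤ v₁
  injective : ∀ t : ℝ, Function.Injective (r₂ t)
  initial : ∀ r₀ : F, r₂ t₀ r₀ = r₀

variable {F : Set Space}

/-- The time delay `T(r₁, t, r₀)`: the solution `T` of `T = |r₁ - r₂(t - T, r₀)|`.
For a flow of matter it exists and is unique, see `IsFlowOfMatter.existsUnique_timeDelay`. -/
def timeDelay (r₂ : ℝ → F → Space) (r₀ : F) (x : SpaceTime) : ℝ :=
  Classical.epsilon fun T : ℝ => T = ‖x.1 - r₂ (x.2 - T) r₀‖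

theorem IsFlowOfMatter.existsUnique_timeDelay {t₀ : ℝ} {r₂ : ℝ → F → Space}
    (h : IsFlowOfMatter F t₀ r₂) (r₀ : F) (x : SpaceTime) :
    ∃! T : ℝ, T = ‖x.1 - r₂ (x.2 - T) r₀‖ := by
  obtain ⟨v, hv1, hv⟩ := h.speed_le x.2
  have hv0 : 0 ≤ v := (norm_nonneg _).trans (hv x.2 le_rfl r₀)
  have hd : Differentiable ℝ fun t => r₂ t r₀ := (h.contDiff r₀).differentiable (by simp)
  have hlip : ∀ s ≤ x.2, ∀ s' ≤ x.2, ‖r₂ s r₀ - r₂ s' r₀‖ ≤ v * ‖s - s'‖ := by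
    intro s hs s' hs'
    exact (convex_Iic x.2).norm_image_sub_le_of_norm_deriv_le (f := fun t => r₂ t r₀)
      (fun y _ => hd y) (fun y hy => hv y hy r₀) hs' hs
  have hK : ContractingWith (⟨v, hv0⟩ : NNReal)
      (fun T : ℝ => ‖x.1 - r₂ (x.2 - max T 0) r₀‖) := by
    refine ⟨by exact_mod_cast hv1, LipschitzWith.of_dist_le_mul fun a b => ?_⟩
    have h1 := hlip (x.2 - max b 0) (by simp) (x.2 - max a 0) (by simp)
    have h2 : |(x.2 - max b 0) - (x.2 - max a 0)| ≤ |a - b| := by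
      have := abs_max_sub_max_le_abs a b 0
      rwa [show (x.2 - max b 0) - (x.2 - max a 0) = max a 0 - max b 0 by ring]
    rw [Real.norm_eq_abs] at h1
    rw [Real.dist_eq, Real.dist_eq]
    calc _ ≤ ‖(x.1 - r₂ (x.2 - max a 0) r₀) - (x.1 - r₂ (x.2 - max b 0) r₀)‖ :=
          abs_norm_sub_norm_le _ _
      _ = ‖r₂ (x.2 - max b 0) r₀ - r₂ (x.2 - max a 0) r₀‖ := by congr 1; abel
      _ ≤ v * |a - b| := h1.trans (mul_le_mul_of_nonneg_left h2 hv0)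
  have hfix := hK.fixedPoint_isFixedPt
  refine ⟨hK.fixedPoint, ?_, fun T hT => ?_⟩
  · have h0 : 0 ≤ hK.fixedPoint := by
      rw [← hfix.eq]; exact norm_nonneg _
    have h1 := hfix.eq
    simp only [max_eq_left h0] at h1
    exact h1.symm
  · have hT' : T = ‖x.1 - r₂ (x.2 - T) r₀‖ := hT
    have h0 : 0 ≤ T := by rw [hT']; exact norm_nonneg _
    refine hK.fixedPoint_unique ?_
    change ‖x.1 - r₂ (x.2 - max T 0) r₀‖ = T
    rw [max_eq_left h0]
    exact hT'.symm

theorem IsFlowOfMatter.timeDelay_eq {t₀ : ℝ} {r₂ : ℝ → F → Space}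
    (h : IsFlowOfMatter F t₀ r₂) (r₀ : F) (x : SpaceTime) :
    timeDelay r₂ r₀ x = ‖x.1 - r₂ (x.2 - timeDelay r₂ r₀ x) r₀‖ :=
  Classical.epsilon_spec (p := fun T : ℝ => T = ‖x.1 - r₂ (x.2 - T) r₀‖)
    (h.existsUnique_timeDelay r₀ x).exists

/-- Retarded time `τ = t - T`. -/
def retardedTime (r₂ : ℝ → F → Space) (r₀ : F) (x : SpaceTime) : ℝ :=
  x.2 - timeDelay r₂ r₀ x

/-- Retarded velocity `v = v₂(τ, r₀)`, where `v₂ = ∂r₂/∂t`. -/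
def retardedVelocity (r₂ : ℝ → F → Space) (r₀ : F) (x : SpaceTime) : Space :=
  deriv (fun s => r₂ s r₀) (retardedTime r₂ r₀ x)

/-- The field `u = 1 / T` (meaningful where `T > 0`). -/
def uField (r₂ : ℝ → F → Space) (r₀ : F) (x : SpaceTime) : ℝ :=
  1 / timeDelay r₂ r₀ x

/-- The unit vector field `e = r₁₂ / T`, `r₁₂ = r₁ - r₂(τ, r₀)` (meaningful where `T > 0`). -/
def eField (r₂ : ℝ → F → Space) (r₀ : F) (x : SpaceTime) : Space :=
  (1 / timeDelay r₂ r₀ x) • (x.1 - r₂ (retardedTime r₂ r₀ x) r₀)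

/-- The field `z = 1 / (1 - ⟨e, v⟩)` (meaningful where `T > 0`). -/
def zField (r₂ : ℝ → F → Space) (r₀ : F) (x : SpaceTime) : ℝ :=
  1 / (1 - inner ℝ (eField r₂ r₀ x) (retardedVelocity r₂ r₀ x))

/-- Pointwise partial derivative with respect to time of a function of `(r₁, t)`. -/
def timeDeriv (f : SpaceTime → Space) (x : SpaceTime) : Space :=
  deriv (fun s => f (x.1, s)) x.2

/-- The vector field `u² e`. -/
def uSqE (r₂ : ℝ → F → Space) (r₀ : F) (x : SpaceTime) : Space :=
  uField r₂ r₀ x ^ 2 • eField r₂ r₀ x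

/-- The vector field `u² e + u⁻¹ ∂ₜ(u² e) + ∂ₜ² e` (meaningful where `T > 0`). -/
def feynmanField (r₂ : ℝ → F → Space) (r₀ : F) (x : SpaceTime) : Space :=
  uSqE r₂ r₀ x + (uField r₂ r₀ x)⁻¹ • timeDeriv (uSqE r₂ r₀) x
    + timeDeriv (timeDeriv (eField r₂ r₀)) x

/-- The cross product in Euclidean space. -/
def cross (a b : Space) : Space := WithLp.toLp 2 (crossProduct a.ofLp b.ofLp)

/-! ### Generalized functions on `R⁴` -/

/-- Generalized scalar functions on `R⁴`. -/
abbrev ScalarDistribution : Type := 𝓓'((⊤ : Opens SpaceTime), ℝ)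

/-- Generalized vector functions on `R⁴`, identified with triples of generalized scalar
functions. -/
abbrev VectorDistribution : Type := Fin 3 → ScalarDistribution

/-- The distributional partial derivative `Dᵢ` in the `i`-th space direction. -/
def dSpace (i : Fin 3) (f : ScalarDistribution) : ScalarDistribution :=
  ∂_{((EuclideanSpace.single i 1, 0) : SpaceTime)} f

/-- The distributional partial derivative `D = ∂/∂t`. -/
def dTime (f : ScalarDistribution) : ScalarDistribution :=
  ∂_{((0, 1) : SpaceTime)} f

/-- `∂/∂t` of a vector distribution. -/
def dTimeVec (A : VectorDistribution) : VectorDistribution := fun i => dTime (A i)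

/-- `∇f`. -/
def grad (f : ScalarDistribution) : VectorDistribution := fun i => dSpace i f

/-- `∇ · A`. -/
def divergence (A : VectorDistribution) : ScalarDistribution :=
  dSpace 0 (A 0) + dSpace 1 (A 1) + dSpace 2 (A 2)

/-- `∇ × A`. -/
def curl (A : VectorDistribution) : VectorDistribution :=
  ![dSpace 1 (A 2) - dSpace 2 (A 1),
    dSpace 2 (A 0) - dSpace 0 (A 2),
    dSpace 0 (A 1) - dSpace 1 (A 0)]

/-- The d'Alembertian `□² = ∇² - ∂²/∂t²`. -/
def box (f : ScalarDistribution) : ScalarDistribution :=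
  divergence (grad f) - dTime (dTime f)

/-- The d'Alembertian of a vector distribution, taken componentwise. -/
def boxVec (A : VectorDistribution) : VectorDistribution := fun i => box (A i)

/-! ### Integrals of generalized functions against a charge -/

/-- `H = ∫_F f(·, r₀) q(dr₀)` as a generalized function: every function `f(·, r₀)` is locally
integrable on `R⁴`, hence is a distribution `g ↦ ∫ g f(·, r₀)`, and for every test function `g` the
number `⟨H, g⟩` is the (absolutely convergent) integral of `r₀ ↦ ⟨f(·, r₀), g⟩` against the signed
measure `q`. -/
def IsChargeIntegral (q : SignedMeasure F) (f : F → SpaceTime → ℝ) (H : ScalarDistribution) :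
    Prop :=
  (∀ r₀ : F, LocallyIntegrable (f r₀)) ∧
  ∀ g : 𝓓((⊤ : Opens SpaceTime), ℝ),
    q.Integrable (fun r₀ => ∫ x, g x * f r₀ x) ∧
    H g = ∫ᵛ r₀, (∫ x, g x * f r₀ x) ∂•q

/-- The same notion for vector fields, componentwise. -/
def IsChargeIntegralVec (q : SignedMeasure F) (f : F → SpaceTime → Space)
    (H : VectorDistribution) : Prop :=
  ∀ i : Fin 3, IsChargeIntegral q (fun r₀ x => f r₀ x i) (H i)

theorem IsChargeIntegral.unique {q : SignedMeasure F} {f : F → SpaceTime → ℝ}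
    {H H' : ScalarDistribution} (h : IsChargeIntegral q f H) (h' : IsChargeIntegral q f H') :
    H = H' := by
  ext g
  rw [(h.2 g).2, (h'.2 g).2]

/-- `φ = ∫_F u z dq`. -/
def IsScalarPotential (r₂ : ℝ → F → Space) (q : SignedMeasure F) (φ : ScalarDistribution) : Prop :=
  IsChargeIntegral q (fun r₀ x => uField r₂ r₀ x * zField r₂ r₀ x) φ

/-- `A = ∫_F u z v dq`. -/
def IsVectorPotential (r₂ : ℝ → F → Space) (q : SignedMeasure F) (A : VectorDistribution) : Prop :=
  IsChargeIntegralVec q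
    (fun r₀ x => (uField r₂ r₀ x * zField r₂ r₀ x) • retardedVelocity r₂ r₀ x) A

end MatterFlow

end

open MatterFlow

noncomputable section

open MeasureTheory Set TopologicalSpace Filter Topology
open scoped Distributions ContDiff LineDeriv ENNReal

namespace MatterFlow

/-! ### Calculus of distributional derivatives -/

/-! Since $S$ and $J$ are defined as $-\Box\phi$ and $-\Box A$, Maxwell's equations and the
continuity equation follow formally from commuting derivatives and the Lorenz gauge $\nabla\cdot
A+\partial_t\phi=0$. What has to be proved is that gauge condition and the formulas for $E$ and $B$.
All of these involve only first derivatives of the potentials, so the distributional second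
derivatives are never computed.

Put $R=r_1-r_2(\tau)$ and $P=T-\langle R,v\rangle$, so that $uz=1/P$. The speed bound makes $P$
comparable with $T$ on compact sets, uniformly in $r_0$, and $T$ is at least half the simultaneous
distance $|r_1-r_2(t)|$. Hence the kernels $1/P$ and $v/P$ are $O(1/T)$ and their pointwise first
derivatives are $O(1/T^2)$. Both are locally integrable, because $|w|^{-2}$ is locally integrable in
three dimensions. This gives the existence of the potentials (`exists_isChargeIntegral`).

Integration by parts against the cutoff $\chi(nT)$ (`integral_testFunction_lineDeriv_mul`) shows
that no singular contribution arises on the world line: the first distributional derivatives are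
given by the pointwise ones. The gauge condition and the two field formulas then reduce to algebraic
identities where $T>0$: `lorenz_kernel`, `electric_kernel` and `magnetic_kernel`. -/

theorem testFunction_lineDerivOp_apply (v : SpaceTime) (g : 𝓓((⊤ : Opens SpaceTime), ℝ))
    (x : SpaceTime) : (∂_{v} g) x = fderiv ℝ g x v := by
  have h : Differentiable ℝ g := g.contDiff.differentiable (by simp)
  rw [TestFunction.lineDerivOp_eq_lineDerivCLM ℝ, TestFunction.lineDerivCLM_apply_of_le (by simp),
    (h x).lineDeriv_eq_fderiv]

theorem testFunction_lineDerivOp_comm (v w : SpaceTime) (g : 𝓓((⊤ : Opens SpaceTime), ℝ)) :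
    ∂_{v} (∂_{w} g) = ∂_{w} (∂_{v} g) := by
  have hg : ContDiff ℝ ∞ g := g.contDiff
  have hd : Differentiable ℝ (fderiv ℝ g) :=
    (hg.fderiv_right (m := ∞) (by simp)).differentiable (by simp)
  have key : ∀ v w : SpaceTime, ∀ x, (∂_{v} (∂_{w} g)) x = fderiv ℝ (fderiv ℝ g) x v w := by
    intro v w x
    have : ⇑(∂_{w} g : 𝓓((⊤ : Opens SpaceTime), ℝ)) = fun y => fderiv ℝ g y w :=
      funext (testFunction_lineDerivOp_apply w g)
    rw [testFunction_lineDerivOp_apply, this, fderiv_clm_apply (hd x) (by fun_prop)]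
    simp
  ext x
  rw [key, key]
  exact hg.contDiffAt.isSymmSndFDerivAt
    (by simpa using WithTop.coe_le_coe.2 (le_top (a := (2 : ℕ∞)))) v w

theorem lineDerivOp_comm (v w : SpaceTime) (f : ScalarDistribution) :
    ∂_{v} (∂_{w} f) = ∂_{w} (∂_{v} f) := by
  ext g
  simp only [Distribution.lineDerivOp_apply_apply, LineDeriv.lineDerivOp_neg, neg_neg]
  rw [testFunction_lineDerivOp_comm]

theorem dSpace_add (i : Fin 3) (f g : ScalarDistribution) :
    dSpace i (f + g) = dSpace i f + dSpace i g := LineDeriv.lineDerivOp_add _ _ _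

theorem dSpace_neg (i : Fin 3) (f : ScalarDistribution) : dSpace i (-f) = -dSpace i f :=
  LineDeriv.lineDerivOp_neg _ _

theorem dSpace_sub (i : Fin 3) (f g : ScalarDistribution) :
    dSpace i (f - g) = dSpace i f - dSpace i g := by
  rw [sub_eq_add_neg, dSpace_add, dSpace_neg, ← sub_eq_add_neg]

theorem dTime_add (f g : ScalarDistribution) : dTime (f + g) = dTime f + dTime g :=
  LineDeriv.lineDerivOp_add _ _ _

theorem dTime_neg (f : ScalarDistribution) : dTime (-f) = -dTime f :=
  LineDeriv.lineDerivOp_neg _ _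

theorem dTime_sub (f g : ScalarDistribution) : dTime (f - g) = dTime f - dTime g := by
  rw [sub_eq_add_neg, dTime_add, dTime_neg, ← sub_eq_add_neg]

theorem dSpace_comm (i j : Fin 3) (f : ScalarDistribution) :
    dSpace i (dSpace j f) = dSpace j (dSpace i f) := lineDerivOp_comm _ _ _

theorem dTime_dSpace (i : Fin 3) (f : ScalarDistribution) :
    dTime (dSpace i f) = dSpace i (dTime f) := lineDerivOp_comm _ _ _

/-! ### Maxwell's equations and continuity as formal consequences of the Lorenz gauge. -/

section Maxwell

variable {φ : ScalarDistribution} {A : VectorDistribution}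

theorem divergence_electric (hL : divergence A + dTime φ = 0) :
    divergence (-grad φ - dTimeVec A) = -box φ := by
  have h : dTime (divergence A) = -dTime (dTime φ) := by
    rw [← add_eq_zero_iff_eq_neg, ← dTime_add, hL]
    simpa using dTime_sub 0 0
  simp only [divergence, box, grad, dTimeVec, Pi.sub_apply, Pi.neg_apply, dSpace_sub, dSpace_neg,
    dTime_add, dTime_dSpace] at h ⊢
  rw [← sub_eq_zero] at h ⊢
  rw [← neg_eq_zero, ← h]
  abel

theorem curl_electric : curl (-grad φ - dTimeVec A) = -dTimeVec (curl A) := by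
  ext1 i
  fin_cases i <;>
  simp only [curl, grad, dTimeVec, Pi.sub_apply, Pi.neg_apply, dSpace_sub, dSpace_neg, dTime_sub,
    dTime_dSpace, Fin.zero_eta, Fin.mk_one, Fin.reduceFinMk, Matrix.cons_val]
  · rw [dSpace_comm 1 2]; abel
  · rw [dSpace_comm 2 0]; abel
  · rw [dSpace_comm 0 1]; abel

theorem divergence_curl : divergence (curl A) = 0 := by
  simp only [divergence, curl, Matrix.cons_val, dSpace_sub]
  rw [dSpace_comm 1 0, dSpace_comm 2 0, dSpace_comm 2 1]
  abel

theorem curl_curl (hL : divergence A + dTime φ = 0) :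
    curl (curl A) = dTimeVec (-grad φ - dTimeVec A) + -boxVec A := by
  have h : ∀ i, dSpace i (divergence A) = -dSpace i (dTime φ) := fun i => by
    rw [← add_eq_zero_iff_eq_neg, ← dSpace_add, hL]
    simpa using dSpace_sub i 0 0
  simp only [divergence, dSpace_add] at h
  ext1 i
  have hi := h i
  rw [← sub_eq_zero] at hi ⊢
  rw [← hi]
  fin_cases i <;>
  simp only [curl, boxVec, box, divergence, grad, dTimeVec, Pi.add_apply, Pi.sub_apply,
    Pi.neg_apply, dSpace_sub, dTime_sub, dTime_neg, dTime_dSpace, Fin.zero_eta, Fin.mk_one,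
    Fin.reduceFinMk, Matrix.cons_val]
  · rw [dSpace_comm 1 0, dSpace_comm 2 0]; abel
  · rw [dSpace_comm 2 1, dSpace_comm 0 1]; abel
  · rw [dSpace_comm 0 2, dSpace_comm 1 2]; abel

theorem box_dSpace (i : Fin 3) (f : ScalarDistribution) : box (dSpace i f) = dSpace i (box f) := by
  simp only [box, divergence, grad, dSpace_sub, dSpace_add, dTime_dSpace]
  simp only [dSpace_comm _ i]

theorem box_dTime (f : ScalarDistribution) : box (dTime f) = dTime (box f) := by
  simp only [box, divergence, grad, dTime_sub, dTime_add, dTime_dSpace]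

theorem box_add (f g : ScalarDistribution) : box (f + g) = box f + box g := by
  simp only [box, divergence, grad, dSpace_add, dTime_add]
  abel

/-- The d'Alembertian has constant coefficients, so it can be applied to the gauge condition term by
term. -/
theorem continuity_equation (hL : divergence A + dTime φ = 0) :
    divergence (-boxVec A) + dTime (-box φ) = 0 := by
  have h : box (divergence A + dTime φ) = 0 := by
    rw [hL]
    simpa using box_add 0 0
  simp only [divergence, box_add, box_dSpace, box_dTime] at h
  simp only [divergence, boxVec, Pi.neg_apply, dSpace_neg, dTime_neg]
  rw [← neg_eq_zero, ← h]
  abel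

end Maxwell

/-! ### Existence of charge integrals -/

variable {F : Set Space}

instance isFiniteMeasure_variation (q : SignedMeasure F) : IsFiniteMeasure q.variation := by
  rw [← SignedMeasure.totalVariation_eq_variation]
  infer_instance

theorem integrable_testFunction_mul {f : SpaceTime → ℝ} (hf : LocallyIntegrable f)
    (g : 𝓓((⊤ : Opens SpaceTime), ℝ)) : Integrable fun x => g x * f x := by
  simpa using TestFunction.integrable_bilin (𝕜 := ℝ) (ContinuousLinearMap.mul ℝ ℝ)
    (hf.locallyIntegrableOn _) g

theorem norm_integral_testFunction_mul_le {f : SpaceTime → ℝ} {g : SpaceTime → ℝ}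
    {K : Set SpaceTime} {b : ℝ} {C : ℝ≥0∞} (hb : ∀ x, |g x| ≤ b) (hK : ∀ x ∉ K, g x = 0)
    (hC : C ≠ ⊤) (hf : ∫⁻ x in K, ‖f x‖ₑ ≤ C) : ‖∫ x, g x * f x‖ ≤ b * C.toReal := by
  have hb0 : 0 ≤ b := (abs_nonneg _).trans (hb 0)
  have h1 : ∫ x, g x * f x = ∫ x in K, g x * f x := by
    rw [setIntegral_eq_integral_of_forall_compl_eq_zero]
    intro x hx
    rw [hK x hx, zero_mul]
  have h2 : ‖∫ x in K, g x * f x‖ₑ ≤ ENNReal.ofReal b * C := by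
    refine (enorm_integral_le_lintegral_enorm _).trans ?_
    refine le_trans ?_ (mul_le_mul_right hf _)
    rw [← lintegral_const_mul' _ _ (by simp)]
    refine lintegral_mono fun x => ?_
    rw [enorm_mul]
    refine mul_le_mul_left ?_ _
    rw [Real.enorm_eq_ofReal_abs]
    exact ENNReal.ofReal_le_ofReal (hb x)
  rw [h1, ← toReal_enorm, ← ENNReal.toReal_ofReal hb0, ← ENNReal.toReal_mul]
  exact ENNReal.toReal_mono (by finiteness) h2

/-- A linear functional controlled by the sup norm on each compact set is a distribution of order
zero. -/
theorem exists_distribution_of_bound (L : 𝓓((⊤ : Opens SpaceTime), ℝ) → ℝ)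
    (hadd : ∀ g g', L (g + g') = L g + L g') (hsmul : ∀ (c : ℝ) g, L (c • g) = c • L g)
    (hb : ∀ K : Set SpaceTime, IsCompact K → ∃ C, 0 ≤ C ∧
      ∀ (g : 𝓓((⊤ : Opens SpaceTime), ℝ)) (b : ℝ),
        (∀ x, |g x| ≤ b) → (∀ x ∉ K, g x = 0) → |L g| ≤ C * b) :
    ∃ H : ScalarDistribution, ∀ g, H g = L g := by
  have hcont : ∀ (K : Compacts SpaceTime) (hK : (K : Set SpaceTime) ⊆ (⊤ : Opens SpaceTime)),
      Continuous (L ∘ TestFunction.ofSupportedIn hK) := by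
    intro K hK
    obtain ⟨C, hC0, hC⟩ := hb K K.isCompact
    refine (ContDiffMapSupportedIn.mkCLMtoNormedSpace (𝕜 := ℝ)
      (L ∘ TestFunction.ofSupportedIn hK)
      (fun g g' => hadd (TestFunction.ofSupportedIn hK g) (TestFunction.ofSupportedIn hK g'))
      (fun c g => hsmul c (TestFunction.ofSupportedIn hK g))
      -- Only the seminorm of index $0$, the sup norm without derivatives, is needed.
      ⟨{0}, C, hC0, fun g => ?_⟩).continuous
    rw [Finset.sup_singleton]
    exact hC _ _ (fun x => ContDiffMapSupportedIn.norm_apply_le_seminorm ℝ (f := g))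
      fun x hx => g.zero_on_compl hx
  exact ⟨TestFunction.mkCLM ℝ L hadd hsmul hcont, fun g => rfl⟩

/-- An $L^1$ bound on compact sets that is uniform in $r_0$ serves twice: it makes the pairing with
a test function bounded in $r_0$, hence integrable against the finite measure $|q|$, and it bounds
the resulting functional by the sup norm. -/
theorem exists_isChargeIntegral (q : SignedMeasure F) {f : F → SpaceTime → ℝ}
    (hm : Measurable (Function.uncurry f))
    (hb : ∀ K : Set SpaceTime, IsCompact K →
      ∃ C : ℝ≥0∞, C ≠ ⊤ ∧ ∀ r₀, ∫⁻ x in K, ‖f r₀ x‖ₑ ≤ C) :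
    ∃ H : ScalarDistribution, IsChargeIntegral q f H := by
  have hloc : ∀ r₀, LocallyIntegrable (f r₀) := fun r₀ => by
    rw [locallyIntegrable_iff]
    intro K hK
    obtain ⟨C, hC, h⟩ := hb K hK
    exact ⟨(hm.comp measurable_prodMk_left).aestronglyMeasurable,
      (h r₀).trans_lt hC.lt_top⟩
  have hmeas : ∀ g : 𝓓((⊤ : Opens SpaceTime), ℝ),
      StronglyMeasurable fun r₀ => ∫ x, g x * f r₀ x := by
    intro g
    have hm' : Measurable fun p : F × SpaceTime => g p.2 * f p.1 p.2 :=
      (g.continuous.measurable.comp measurable_snd).mul hm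
    exact hm'.stronglyMeasurable.integral_prod_right
  have hint : ∀ g : 𝓓((⊤ : Opens SpaceTime), ℝ),
      q.Integrable fun r₀ => ∫ x, g x * f r₀ x := by
    intro g
    obtain ⟨C, hC, h⟩ := hb _ g.hasCompactSupport
    obtain ⟨b, hgb⟩ := g.hasCompactSupport.exists_bound_of_continuous g.continuous
    refine Integrable.of_bound (hmeas g).aestronglyMeasurable (b * C.toReal)
      (Eventually.of_forall fun r₀ => ?_)
    exact norm_integral_testFunction_mul_le hgb (fun x => image_eq_zero_of_notMem_tsupport) hC
      (h r₀)
  have hadd : ∀ g g' : 𝓓((⊤ : Opens SpaceTime), ℝ),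
      ∫ᵛ r₀, (∫ x, (g + g') x * f r₀ x) ∂•q =
        ∫ᵛ r₀, (∫ x, g x * f r₀ x) ∂•q + ∫ᵛ r₀, (∫ x, g' x * f r₀ x) ∂•q := by
    intro g g'
    rw [← VectorMeasure.integral_fun_add (hint g) (hint g')]
    congr 1
    ext r₀
    rw [← integral_add (integrable_testFunction_mul (hloc r₀) g)
      (integrable_testFunction_mul (hloc r₀) g')]
    simp [add_mul]
  have hsmul : ∀ (c : ℝ) (g : 𝓓((⊤ : Opens SpaceTime), ℝ)),
      ∫ᵛ r₀, (∫ x, (c • g) x * f r₀ x) ∂•q = c • ∫ᵛ r₀, (∫ x, g x * f r₀ x) ∂•q := by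
    intro c g
    rw [← VectorMeasure.integral_fun_smul]
    congr 1
    ext r₀
    rw [smul_eq_mul, ← integral_const_mul]
    simp [mul_assoc]
  obtain ⟨H, hH⟩ := exists_distribution_of_bound
    (fun g => ∫ᵛ r₀, (∫ x, g x * f r₀ x) ∂•q) hadd hsmul fun K hK => by
      obtain ⟨C, hC, h⟩ := hb K hK
      refine ⟨C.toReal * ‖ContinuousLinearMap.lsmul ℝ ℝ (E := ℝ)‖ * q.variation.real univ,
        by positivity, fun g b hgb hgK => ?_⟩
      refine (VectorMeasure.norm_integral_le_of_norm_le_const (μ := q)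
        (B := ContinuousLinearMap.lsmul ℝ ℝ (E := ℝ)) (f := fun r₀ => ∫ x, g x * f r₀ x)
        (C := b * C.toReal)
        (Eventually.of_forall fun r₀ =>
          norm_integral_testFunction_mul_le hgb hgK hC (h r₀))).trans (le_of_eq ?_)
      ring
  exact ⟨H, hloc, fun g => ⟨hint g, hH g⟩⟩

/-! ### Inverse powers of the distance to a moving point -/

/-- In polar coordinates the volume factor $y^2$ absorbs $y^{-k}$. -/
theorem integrableOn_ball_inv_norm_pow {k : ℕ} (hk : k ≤ 2) (ρ : ℝ) :
    IntegrableOn (fun w : Space => ‖w‖⁻¹ ^ k) (Metric.ball 0 ρ) := by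
  rw [integrableOn_fun_norm_addHaar (volume : Measure Space) (f := fun y : ℝ => y⁻¹ ^ k)]
  have h : IntegrableOn (fun y : ℝ => y ^ (2 - k)) (Ioo 0 ρ) :=
    (((continuous_pow (2 - k)).continuousOn (s := Icc 0 ρ)).integrableOn_Icc).mono_set
      Ioo_subset_Icc_self
  refine h.congr_fun (fun y hy => ?_) measurableSet_Ioo
  have hy : y ≠ 0 := hy.1.ne'
  simp only [finrank_euclideanSpace, Fintype.card_fin, smul_eq_mul]
  rw [inv_pow, ← div_eq_mul_inv, eq_div_iff (by positivity), ← pow_add]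
  congr 1
  omega

/-- The bound is independent of the trajectory: in each time slice a translation moves the
singularity to the origin and the domain into a fixed ball. -/
theorem exists_lintegral_inv_dist_pow_le {k : ℕ} (hk : k ≤ 2) (ρ M : ℝ) :
    ∃ C : ℝ≥0∞, C ≠ ⊤ ∧ ∀ a : ℝ → Space, Continuous a →
      (∀ t ∈ Metric.closedBall (0 : ℝ) ρ, ‖a t‖ ≤ M) →
        ∫⁻ x in Metric.closedBall (0 : SpaceTime) ρ, ENNReal.ofReal (‖x.1 - a x.2‖⁻¹ ^ k) ≤ C := by
  set I : ℝ≥0∞ := ∫⁻ w in Metric.ball (0 : Space) (ρ + M + 1), ENNReal.ofReal (‖w‖⁻¹ ^ k)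
  have hI : I ≠ ⊤ := by
    have h := (integrableOn_ball_inv_norm_pow hk (ρ + M + 1)).2
    rw [hasFiniteIntegral_iff_ofReal (Eventually.of_forall fun w => by positivity)] at h
    exact h.ne
  refine ⟨I * volume (Metric.closedBall (0 : ℝ) ρ), ?_, fun a ha hM => ?_⟩
  · exact ENNReal.mul_ne_top hI measure_closedBall_lt_top.ne
  have hball : Metric.closedBall (0 : SpaceTime) ρ =
      Metric.closedBall (0 : Space) ρ ×ˢ Metric.closedBall (0 : ℝ) ρ :=
    (closedBall_prod_same (0 : Space) (0 : ℝ) ρ).symm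
  have hm : Measurable fun x : SpaceTime => ENNReal.ofReal (‖x.1 - a x.2‖⁻¹ ^ k) := by
    have : Measurable fun x : SpaceTime => ‖x.1 - a x.2‖ := by
      apply Continuous.measurable
      fun_prop
    exact (this.inv.pow_const k).ennreal_ofReal
  rw [hball, Measure.volume_eq_prod, ← Measure.prod_restrict, lintegral_prod_symm' _ hm]
  refine (setLIntegral_mono (measurable_const (a := I)) fun t ht => ?_).trans (by simp)
  change _ ≤ ∫⁻ w in Metric.ball (0 : Space) (ρ + M + 1), ENNReal.ofReal (‖w‖⁻¹ ^ k)
  -- After translation by `a t` the closed ball of radius `ρ` has norms at most `ρ + M`; the extra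
  -- `1` lets an open ball contain it.
  rw [← lintegral_indicator Metric.isClosed_closedBall.measurableSet,
    ← lintegral_indicator measurableSet_ball,
    ← lintegral_sub_right_eq_self (fun w : Space => (Metric.ball (0 : Space) (ρ + M + 1)).indicator
      (fun w => ENNReal.ofReal (‖w‖⁻¹ ^ k)) w) (a t)]
  refine lintegral_mono fun r => ?_
  by_cases hr : r ∈ Metric.closedBall (0 : Space) ρ
  · rw [indicator_of_mem hr, indicator_of_mem]
    have h1 := norm_sub_le r (a t)
    have h2 := hM t ht
    simp only [Metric.mem_closedBall, dist_zero_right, Metric.mem_ball] at hr ⊢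
    linarith
  · rw [indicator_of_notMem hr]
    exact zero_le

/-- Each time slice of the world line is a single point, so Fubini applies. -/
theorem ae_ne_moving_point {a : ℝ → Space} (ha : Continuous a) :
    ∀ᵐ x : SpaceTime, x.1 - a x.2 ≠ 0 := by
  have hs : MeasurableSet {x : SpaceTime | x.1 - a x.2 = 0} :=
    (isClosed_eq (by fun_prop) continuous_const).measurableSet
  rw [ae_iff]
  simp only [ne_eq, not_not]
  rw [Measure.volume_eq_prod, Measure.prod_apply_symm hs]
  simp [sub_eq_zero]

/-! ### Integration by parts with a singularity -/

theorem tendsto_integral_mul_comp_nsmul {T h : SpaceTime → ℝ} {c : ℝ → ℝ} {b l : ℝ}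
    (hT : Continuous T) (hT0 : ∀ᵐ x, 0 < T x) (hh : Integrable h) (hc : Continuous c)
    (hb : ∀ s, |c s| ≤ b) (hl : ∀ s, 2 < s → c s = l) :
    Tendsto (fun n : ℕ => ∫ x, h x * c (n * T x)) atTop (𝓝 (∫ x, h x * l)) := by
  refine tendsto_integral_of_dominated_convergence (fun x => ‖h x‖ * b) (fun n => ?_)
    (hh.norm.mul_const b) (fun n => Eventually.of_forall fun x => ?_) ?_
  · exact hh.aestronglyMeasurable.mul
      (hc.comp (continuous_const.mul hT)).aestronglyMeasurable
  · rw [norm_mul]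
    exact mul_le_mul_of_nonneg_left (hb _) (norm_nonneg _)
  · filter_upwards [hT0] with x hx
    refine tendsto_const_nhds.congr' ?_
    have : Tendsto (fun n : ℕ => (n : ℝ) * T x) atTop atTop :=
      tendsto_natCast_atTop_atTop.atTop_mul_const hx
    filter_upwards [this.eventually_gt_atTop 2] with n hn
    rw [hl _ hn]

/-- The last bound is what controls the derivative of $\chi(nT)$ uniformly in $n$: $\chi'$ lives on
$[1,2]$, so $s\chi'(s)$ is bounded. -/
theorem exists_cutoff : ∃ χ χ' : ℝ → ℝ, Continuous χ ∧ Continuous χ' ∧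
    (∀ s, HasDerivAt χ (χ' s) s) ∧ (∀ s < 1, χ s = 0) ∧ (∀ s, 2 < s → χ s = 1) ∧
    (∀ s, |χ s| ≤ 1) ∧ (∀ s, 2 < s → χ' s = 0) ∧
    ∃ b, ∀ s, |χ' s * s| ≤ b := by
  set χ : ℝ → ℝ := fun s => Real.smoothTransition (s - 1)
  have hχ : ContDiff ℝ 1 χ := Real.smoothTransition.contDiff.comp (by fun_prop)
  have h0 : ∀ s < 1, χ s = 0 := fun s hs =>
    Real.smoothTransition.zero_of_nonpos (by linarith)
  have h1 : ∀ s, 2 < s → χ s = 1 := fun s hs =>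
    Real.smoothTransition.one_of_one_le (by linarith)
  have hd0 : ∀ s < 1, deriv χ s = 0 := fun s hs => by
    have : χ =ᶠ[𝓝 s] fun _ => 0 := by
      filter_upwards [Iio_mem_nhds hs] with y hy using h0 y hy
    rw [this.deriv_eq, deriv_const]
  have hd1 : ∀ s, 2 < s → deriv χ s = 0 := fun s hs => by
    have : χ =ᶠ[𝓝 s] fun _ => 1 := by
      filter_upwards [Ioi_mem_nhds hs] with y hy using h1 y hy
    rw [this.deriv_eq, deriv_const]
  have hcd : Continuous (deriv χ) := hχ.continuous_deriv le_rfl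
  refine ⟨χ, deriv χ, hχ.continuous, hcd,
    fun s => (hχ.differentiable one_ne_zero s).hasDerivAt, h0, h1, fun s => ?_, hd1, ?_⟩
  · rw [abs_of_nonneg (Real.smoothTransition.nonneg _)]
    exact Real.smoothTransition.le_one _
  · obtain ⟨b, hb⟩ := (isCompact_Icc (a := (1 : ℝ)) (b := 2)).exists_bound_of_continuousOn
      (f := fun s => deriv χ s * s) (hcd.mul continuous_id).continuousOn
    refine ⟨b, fun s => ?_⟩
    have hb0 : 0 ≤ b := (norm_nonneg _).trans (hb 1 (by simp))
    rcases lt_or_ge s 1 with hs | hs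
    · simpa [hd0 s hs] using hb0
    rcases lt_or_ge 2 s with hs' | hs'
    · simpa [hd1 s hs'] using hb0
    · exact hb s ⟨hs, hs'⟩

/-- If `f` is differentiable in the direction `d` outside of the null set `T = 0`, and `f`, its
derivative and `f ∂T / T` are locally integrable, then the derivative of the distribution `f`
is its pointwise derivative. -/
theorem integral_testFunction_lineDeriv_mul {T f f' T' : SpaceTime → ℝ} {d : SpaceTime}
    (hT : Continuous T) (hT0 : ∀ᵐ x, 0 < T x) (hTnonneg : ∀ x, 0 ≤ T x)
    (hTd : ∀ x, 0 < T x → HasLineDerivAt ℝ T (T' x) x d)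
    (hfd : ∀ x, 0 < T x → HasLineDerivAt ℝ f (f' x) x d)
    (hf : LocallyIntegrable f) (hf' : LocallyIntegrable f')
    (hfT : LocallyIntegrable fun x => f x * T' x * (T x)⁻¹)
    (g : 𝓓((⊤ : Opens SpaceTime), ℝ)) :
    ∫ x, (∂_{d} g) x * f x = -∫ x, g x * f' x := by
  obtain ⟨χ, χ', hχc, hχc', hχ, hχ0, hχ1, hχb, hχ'1, b, hb⟩ := exists_cutoff
  set gd : 𝓓((⊤ : Opens SpaceTime), ℝ) := ∂_{d} g
  have hψc : Continuous fun s => χ' s * s := hχc'.mul continuous_id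
  have i1 := integrable_testFunction_mul hf gd
  have i2 := integrable_testFunction_mul hf' g
  have i3 := integrable_testFunction_mul hfT g
  have i4 := integrable_testFunction_mul hf g
  have hbdd : ∀ {h : SpaceTime → ℝ} {c : ℝ → ℝ} {b : ℝ}, Integrable h → Continuous c →
      (∀ s, |c s| ≤ b) → ∀ n : ℕ, Integrable fun x => h x * c (n * T x) := fun hh hc hb n =>
    hh.mul_bdd (hc.comp (continuous_const.mul hT)).aestronglyMeasurable
      (Eventually.of_forall fun x => hb _)
  -- Differentiating the cutoff produces $f\,\chi'(nT)\,n\,\partial T$. Writing $n=(nT)/T$ splits it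
  -- into the locally integrable $f\,\partial T/T$ and the bounded $s\chi'(s)$ at $s=nT$.
  have key : ∀ n : ℕ, ∫ x, gd x * f x * χ (n * T x) =
      -((∫ x, g x * f' x * χ (n * T x)) +
        ∫ x, g x * (f x * T' x * (T x)⁻¹) * (χ' (n * T x) * (n * T x))) := by
    intro n
    rw [← integral_add (hbdd i2 hχc hχb n) (hbdd i3 hψc hb n)]
    have : (volume : Measure SpaceTime).IsAddHaarMeasure := by
      rw [Measure.volume_eq_prod]
      infer_instance
    have hibp := integral_bilinear_hasLineDerivAt_right_eq_neg_left_of_integrable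
      (μ := (volume : Measure SpaceTime)) (B := ContinuousLinearMap.mul ℝ ℝ) (v := d)
      (f := fun x => f x * χ (n * T x))
      (f' := fun x => f' x * χ (n * T x) +
        f x * T' x * (T x)⁻¹ * (χ' (n * T x) * (n * T x)))
      (g := g) (g' := gd) ?_ ?_ ?_ ?_ ?_
    · simp only [ContinuousLinearMap.mul_apply'] at hibp
      calc _ = ∫ x, f x * χ (n * T x) * gd x := by congr 1; ext x; ring
        _ = _ := hibp
        _ = _ := by congr 2; ext x; ring
    · refine ((hbdd i2 hχc hχb n).add (hbdd i3 hψc hb n)).congr (Eventually.of_forall fun x => ?_)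
      simp only [Pi.add_apply, ContinuousLinearMap.mul_apply']
      ring
    · refine (hbdd i1 hχc hχb n).congr (Eventually.of_forall fun x => ?_)
      simp only [ContinuousLinearMap.mul_apply']
      ring
    · refine (hbdd i4 hχc hχb n).congr (Eventually.of_forall fun x => ?_)
      simp only [ContinuousLinearMap.mul_apply']
      ring
    · intro x _
      rcases (hTnonneg x).lt_or_eq with hx | hx
      · have h1 : HasDerivAt (fun s : ℝ => T (x + s • d)) (T' x) 0 := hTd x hx
        have h2 : HasDerivAt (fun s : ℝ => f (x + s • d)) (f' x) 0 := hfd x hx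
        have h3 := (hχ (n * T (x + (0 : ℝ) • d))).comp (0 : ℝ) (h1.const_mul (n : ℝ))
        have h4 := h2.mul h3
        rw [HasLineDerivAt]
        refine h4.congr_deriv ?_
        simp only [Function.comp_apply, zero_smul, add_zero]
        field_simp
      -- At a point with $T=0$ the cut-off function vanishes in a whole neighbourhood, and the
      -- proposed derivative is $0$ because $\chi(0)=0$ and $nT=0$.
      · have hx0 : (n : ℝ) * T x = 0 := by rw [← hx, mul_zero]
        have hnear : ∀ᶠ y in 𝓝 x, f y * χ (n * T y) = 0 := by
          have : ∀ᶠ y in 𝓝 x, (n : ℝ) * T y < 1 := by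
            refine (continuous_const.mul hT).continuousAt.eventually_lt_const ?_
            change (n : ℝ) * T x < 1
            rw [hx0]
            exact one_pos
          filter_upwards [this] with y hy
          rw [hχ0 _ hy, mul_zero]
        have hc : Tendsto (fun s : ℝ => x + s • d) (𝓝 0) (𝓝 x) := by
          have : Continuous fun s : ℝ => x + s • d := by fun_prop
          simpa using this.tendsto 0
        rw [HasLineDerivAt]
        simp only [hx0, hχ0 0 one_pos, mul_zero, add_zero]
        exact (hasDerivAt_const (0 : ℝ) (0 : ℝ)).congr_of_eventuallyEq (hc.eventually hnear)
    · intro x _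
      have : gd x = fderiv ℝ g x d := testFunction_lineDerivOp_apply d g x
      rw [this]
      exact ((g.contDiff.differentiable (by simp) x).hasFDerivAt).hasLineDerivAt d
  have l1 := tendsto_integral_mul_comp_nsmul hT hT0 i1 hχc hχb hχ1
  have l2 := tendsto_integral_mul_comp_nsmul hT hT0 i2 hχc hχb hχ1
  -- The cutoff term disappears in the limit because $s\chi'(s)=0$ for $s>2$.
  have l3 := tendsto_integral_mul_comp_nsmul (l := 0) hT hT0 i3 hψc hb
    fun s hs => by simp [hχ'1 s hs]
  have := tendsto_nhds_unique (l1.congr key) (l2.add l3).neg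
  simpa using this

/-! ### Kinematics of a flow of matter -/

/-- Implicit differentiation of `q = ‖R‖` along a curve on which the increments of `R` are
determined by those of `q`. -/
theorem hasDerivAt_of_eq_norm {q : ℝ → ℝ} {R A : ℝ → Space} {d₁ : Space} {d₂ : ℝ}
    (hq : ContinuousAt q 0) (hR : ContinuousAt R 0) (hA : ContinuousAt A 0)
    (hqR : ∀ s, q s = ‖R s‖) (hRA : ∀ s, R s - R 0 = s • d₁ - (s * d₂ - (q s - q 0)) • A s)
    (hP : q 0 - inner ℝ (R 0) (A 0) ≠ 0) :
    HasDerivAt q ((inner ℝ (R 0) d₁ - inner ℝ (R 0) (A 0) * d₂) *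
      (q 0 - inner ℝ (R 0) (A 0))⁻¹) 0 := by
  have hN : ContinuousAt (fun s => inner ℝ (R s + R 0) (d₁ - d₂ • A s)) 0 :=
    (hR.add continuousAt_const).inner (continuousAt_const.sub (hA.const_smul d₂))
  have hD : ContinuousAt (fun s => q s + q 0 - inner ℝ (R s + R 0) (A s)) 0 :=
    (hq.add continuousAt_const).sub ((hR.add continuousAt_const).inner hA)
  have hD0 : q 0 + q 0 - inner ℝ (R 0 + R 0) (A 0) = 2 * (q 0 - inner ℝ (R 0) (A 0)) := by
    rw [inner_add_left]
    ring
  have hDne : q 0 + q 0 - inner ℝ (R 0 + R 0) (A 0) ≠ 0 := by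
    rw [hD0]
    exact mul_ne_zero two_ne_zero hP
  -- The polarised identity $|R_s|^2-|R_0|^2=\langle R_s+R_0,R_s-R_0\rangle$ is linear in the
  -- increment of $q$. Solving it gives the difference quotient exactly, so no implicit function
  -- theorem is required.
  have hrel : ∀ s, (q s - q 0) * (q s + q 0 - inner ℝ (R s + R 0) (A s)) =
      s * inner ℝ (R s + R 0) (d₁ - d₂ • A s) := by
    intro s
    have e : q s * q s - q 0 * q 0 = inner ℝ (R s + R 0) (R s - R 0) := by
      rw [hqR s, hqR 0, ← real_inner_self_eq_norm_mul_norm, ← real_inner_self_eq_norm_mul_norm,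
        inner_sub_right, inner_add_left, inner_add_left, real_inner_comm (R 0) (R s)]
      ring
    rw [hRA, inner_sub_right, real_inner_smul_right, real_inner_smul_right] at e
    rw [inner_sub_right, real_inner_smul_right]
    linear_combination e
  rw [hasDerivAt_iff_tendsto_slope]
  have hval : (inner ℝ (R 0) d₁ - inner ℝ (R 0) (A 0) * d₂) * (q 0 - inner ℝ (R 0) (A 0))⁻¹ =
      inner ℝ (R 0 + R 0) (d₁ - d₂ • A 0) / (q 0 + q 0 - inner ℝ (R 0 + R 0) (A 0)) := by
    rw [hD0, inner_add_left, inner_sub_right, real_inner_smul_right]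
    field_simp
    ring
  rw [hval]
  refine ((hN.div hD hDne).tendsto.mono_left nhdsWithin_le_nhds).congr' ?_
  filter_upwards [(hD.eventually_ne hDne).filter_mono nhdsWithin_le_nhds, self_mem_nhdsWithin]
    with s hs hs0
  have hs0 : s ≠ 0 := hs0
  rw [slope_def_field, sub_zero, Pi.div_apply, div_eq_div_iff hs hs0, hrel s, mul_comm]

section Kinematics

variable {F : Set Space}

/-- The vector `r₁ - r₂(τ, r₀)` from the retarded position to the observer. -/
def displacement (r₂ : ℝ → F → Space) (r₀ : F) (x : SpaceTime) : Space :=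
  x.1 - r₂ (retardedTime r₂ r₀ x) r₀

/-- The retarded acceleration. -/
def retardedAcceleration (r₂ : ℝ → F → Space) (r₀ : F) (x : SpaceTime) : Space :=
  deriv (deriv fun s => r₂ s r₀) (retardedTime r₂ r₀ x)

/-- The Liénard–Wiechert denominator `T - ⟨r₁ - r₂(τ, r₀), v⟩`. -/
def lwDenom (r₂ : ℝ → F → Space) (r₀ : F) (x : SpaceTime) : ℝ :=
  timeDelay r₂ r₀ x - inner ℝ (displacement r₂ r₀ x) (retardedVelocity r₂ r₀ x)

/-- The derivative of the time delay in the direction `d`. -/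
def timeDelayDeriv (r₂ : ℝ → F → Space) (r₀ : F) (d x : SpaceTime) : ℝ :=
  (inner ℝ (displacement r₂ r₀ x) d.1
    - inner ℝ (displacement r₂ r₀ x) (retardedVelocity r₂ r₀ x) * d.2) * (lwDenom r₂ r₀ x)⁻¹

/-- The derivative of the retarded time in the direction `d`. -/
def retardedTimeDeriv (r₂ : ℝ → F → Space) (r₀ : F) (d x : SpaceTime) : ℝ :=
  (timeDelay r₂ r₀ x * d.2 - inner ℝ (displacement r₂ r₀ x) d.1) * (lwDenom r₂ r₀ x)⁻¹

/-- The derivative of the displacement in the direction `d`. -/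
def displacementDeriv (r₂ : ℝ → F → Space) (r₀ : F) (d x : SpaceTime) : Space :=
  d.1 - retardedTimeDeriv r₂ r₀ d x • retardedVelocity r₂ r₀ x

/-- The derivative of the Liénard–Wiechert denominator in the direction `d`. -/
def lwDenomDeriv (r₂ : ℝ → F → Space) (r₀ : F) (d x : SpaceTime) : ℝ :=
  timeDelayDeriv r₂ r₀ d x
    - (inner ℝ (displacement r₂ r₀ x) (retardedTimeDeriv r₂ r₀ d x • retardedAcceleration r₂ r₀ x)
      + inner ℝ (displacementDeriv r₂ r₀ d x) (retardedVelocity r₂ r₀ x))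

namespace IsFlowOfMatter

variable {t₀ : ℝ} {r₂ : ℝ → F → Space} (h : IsFlowOfMatter F t₀ r₂)

include h

theorem continuous_position : Continuous fun p : ℝ × F => r₂ p.1 p.2 := by
  simpa using h.continuous_iteratedDeriv 0

theorem continuous_velocity : Continuous fun p : ℝ × F => deriv (fun t => r₂ t p.2) p.1 := by
  simpa using h.continuous_iteratedDeriv 1

theorem continuous_acceleration :
    Continuous fun p : ℝ × F => deriv (deriv fun t => r₂ t p.2) p.1 := by
  have := h.continuous_iteratedDeriv 2
  simpa only [iteratedDeriv_succ, iteratedDeriv_zero] using this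

theorem contDiff_velocity (r₀ : F) : ContDiff ℝ ∞ (deriv fun t => r₂ t r₀) :=
  ((contDiff_infty_iff_deriv (f := fun t => r₂ t r₀)).1 (h.contDiff r₀)).2

theorem hasDerivAt_position (r₀ : F) (t : ℝ) :
    HasDerivAt (fun s => r₂ s r₀) (deriv (fun s => r₂ s r₀) t) t :=
  ((h.contDiff r₀).differentiable (by simp) t).hasDerivAt

theorem norm_position_sub_le {t₁ v₁ : ℝ} (r₀ : F)
    (hv : ∀ t ≤ t₁, ‖deriv (fun s => r₂ s r₀) t‖ ≤ v₁) {s s' : ℝ} (hs : s ≤ t₁) (hs' : s' ≤ t₁) :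
    ‖r₂ s r₀ - r₂ s' r₀‖ ≤ v₁ * |s - s'| :=
  (convex_Iic t₁).norm_image_sub_le_of_norm_deriv_le (f := fun t => r₂ t r₀)
    (fun y _ => (h.hasDerivAt_position r₀ y).differentiableAt) (fun y hy => hv y hy) hs' hs

theorem timeDelay_eq_norm (r₀ : F) (x : SpaceTime) :
    timeDelay r₂ r₀ x = ‖displacement r₂ r₀ x‖ := h.timeDelay_eq r₀ x

theorem timeDelay_nonneg (r₀ : F) (x : SpaceTime) : 0 ≤ timeDelay r₂ r₀ x := by
  rw [h.timeDelay_eq_norm]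
  exact norm_nonneg _

theorem retardedTime_le (r₀ : F) (x : SpaceTime) : retardedTime r₂ r₀ x ≤ x.2 :=
  sub_le_self _ (h.timeDelay_nonneg r₀ x)

/-- During the delay $T$ the particle, slower than light, moves less than $T$ or not at all. This
compares $T$ with the simultaneous distance, whose singularity lies on an explicit curve. -/
theorem norm_sub_position_le (r₀ : F) (x : SpaceTime) :
    ‖x.1 - r₂ x.2 r₀‖ ≤ 2 * timeDelay r₂ r₀ x := by
  obtain ⟨v, hv1, hv⟩ := h.speed_le x.2
  have h1 := h.norm_position_sub_le r₀ (fun t ht => hv t ht r₀) (h.retardedTime_le r₀ x)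
    (le_refl x.2)
  have hT := h.timeDelay_nonneg r₀ x
  have h2 : |retardedTime r₂ r₀ x - x.2| = timeDelay r₂ r₀ x := by
    rw [retardedTime, sub_sub_cancel_left, abs_neg, abs_of_nonneg hT]
  have h3 : x.1 - r₂ x.2 r₀ =
      displacement r₂ r₀ x + (r₂ (retardedTime r₂ r₀ x) r₀ - r₂ x.2 r₀) := by
    rw [displacement]; abel
  rw [h3]
  refine (norm_add_le _ _).trans ?_
  rw [← h.timeDelay_eq_norm]
  rw [h2] at h1
  nlinarith

/-- The contraction estimate behind uniqueness of $T$ also gives stability: the change of $T$ is at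
most $(1-v)^{-1}$ times the change of the data at the old delay. -/
theorem continuous_timeDelay : Continuous fun p : F × SpaceTime => timeDelay r₂ p.1 p.2 := by
  rw [continuous_iff_continuousAt]
  intro p
  -- The margin `1` gives one speed bound valid for all nearby observation times.
  obtain ⟨v, hv1, hv⟩ := h.speed_le (p.2.2 + 1)
  set T := timeDelay r₂ p.1 p.2
  have hcont : Continuous fun q : F × SpaceTime =>
      (‖q.2.1 - p.2.1‖ + ‖r₂ (q.2.2 - T) q.1 - r₂ (p.2.2 - T) p.1‖) / (1 - v) := by
    have h1 : Continuous fun q : F × SpaceTime => r₂ (q.2.2 - T) q.1 :=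
      h.continuous_position.comp
        (by fun_prop : Continuous fun q : F × SpaceTime => ((q.2.2 - T, q.1) : ℝ × F))
    have h2 : Continuous fun q : F × SpaceTime => q.2.1 := by fun_prop
    exact (((h2.sub continuous_const).norm).add ((h1.sub continuous_const).norm)).div_const _
  have hlim := hcont.tendsto p
  simp only [sub_self, norm_zero, add_zero, zero_div] at hlim
  rw [ContinuousAt, tendsto_iff_norm_sub_tendsto_zero]
  have hev : ∀ᶠ q : F × SpaceTime in 𝓝 p, q.2.2 < p.2.2 + 1 :=
    (by fun_prop : Continuous fun q : F × SpaceTime => q.2.2).continuousAt.eventually_lt_const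
      (by simp)
  refine squeeze_zero' (Eventually.of_forall fun q => norm_nonneg _) ?_ hlim
  filter_upwards [hev] with q hq
  rw [le_div_iff₀ (by linarith), Real.norm_eq_abs]
  set S := timeDelay r₂ q.1 q.2
  have hT0 : 0 ≤ T := h.timeDelay_nonneg _ _
  have hS0 : 0 ≤ S := h.timeDelay_nonneg _ _
  have hS : S = ‖q.2.1 - r₂ (q.2.2 - S) q.1‖ := h.timeDelay_eq q.1 q.2
  have hT : T = ‖p.2.1 - r₂ (p.2.2 - T) p.1‖ := h.timeDelay_eq p.1 p.2
  have h1 : |S - T| ≤ ‖(q.2.1 - r₂ (q.2.2 - S) q.1) - (p.2.1 - r₂ (p.2.2 - T) p.1)‖ := by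
    conv_lhs => rw [hS, hT]
    exact abs_norm_sub_norm_le _ _
  have h2 : (q.2.1 - r₂ (q.2.2 - S) q.1) - (p.2.1 - r₂ (p.2.2 - T) p.1) =
      (q.2.1 - p.2.1) - (r₂ (q.2.2 - T) q.1 - r₂ (p.2.2 - T) p.1)
        - (r₂ (q.2.2 - S) q.1 - r₂ (q.2.2 - T) q.1) := by abel
  have h3 : ‖r₂ (q.2.2 - S) q.1 - r₂ (q.2.2 - T) q.1‖ ≤ v * |S - T| := by
    have := h.norm_position_sub_le q.1 (fun t ht => hv t ht q.1)
      (s := q.2.2 - S) (s' := q.2.2 - T) (by linarith) (by linarith)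
    rwa [sub_sub_sub_cancel_left, abs_sub_comm] at this
  rw [h2] at h1
  have h4 := norm_sub_le ((q.2.1 - p.2.1) - (r₂ (q.2.2 - T) q.1 - r₂ (p.2.2 - T) p.1))
    (r₂ (q.2.2 - S) q.1 - r₂ (q.2.2 - T) q.1)
  have h5 := norm_sub_le (q.2.1 - p.2.1) (r₂ (q.2.2 - T) q.1 - r₂ (p.2.2 - T) p.1)
  linarith

theorem continuous_retardedTime : Continuous fun p : F × SpaceTime => retardedTime r₂ p.1 p.2 :=
  (by fun_prop : Continuous fun p : F × SpaceTime => p.2.2).sub h.continuous_timeDelay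

theorem continuous_displacement : Continuous fun p : F × SpaceTime => displacement r₂ p.1 p.2 :=
  (by fun_prop : Continuous fun p : F × SpaceTime => p.2.1).sub
    (h.continuous_position.comp (h.continuous_retardedTime.prodMk continuous_fst))

theorem continuous_retardedVelocity :
    Continuous fun p : F × SpaceTime => retardedVelocity r₂ p.1 p.2 :=
  h.continuous_velocity.comp (h.continuous_retardedTime.prodMk continuous_fst)

theorem continuous_retardedAcceleration :
    Continuous fun p : F × SpaceTime => retardedAcceleration r₂ p.1 p.2 :=
  h.continuous_acceleration.comp (h.continuous_retardedTime.prodMk continuous_fst)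

theorem continuous_lwDenom : Continuous fun p : F × SpaceTime => lwDenom r₂ p.1 p.2 :=
  h.continuous_timeDelay.sub (h.continuous_displacement.inner h.continuous_retardedVelocity)

theorem lwDenom_ge {t₁ v₁ : ℝ} (r₀ : F) (hv : ∀ t ≤ t₁, ‖deriv (fun s => r₂ s r₀) t‖ ≤ v₁)
    (x : SpaceTime) (hx : x.2 ≤ t₁) :
    (1 - v₁) * timeDelay r₂ r₀ x ≤ lwDenom r₂ r₀ x := by
  have h1 := hv _ ((h.retardedTime_le r₀ x).trans hx)
  have h2 := real_inner_le_norm (displacement r₂ r₀ x) (retardedVelocity r₂ r₀ x)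
  rw [← h.timeDelay_eq_norm, retardedVelocity] at h2
  rw [lwDenom, retardedVelocity]
  nlinarith [h.timeDelay_nonneg r₀ x]

theorem lwDenom_pos (r₀ : F) (x : SpaceTime) (hx : 0 < timeDelay r₂ r₀ x) :
    0 < lwDenom r₂ r₀ x := by
  obtain ⟨v, hv1, hv⟩ := h.speed_le x.2
  exact (mul_pos (by linarith) hx).trans_le (h.lwDenom_ge r₀ (fun t ht => hv t ht r₀) x le_rfl)

theorem displacement_eq_zero (r₀ : F) (x : SpaceTime) (hx : timeDelay r₂ r₀ x = 0) :
    displacement r₂ r₀ x = 0 := by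
  rwa [h.timeDelay_eq_norm, norm_eq_zero] at hx

theorem lwDenom_eq_zero (r₀ : F) (x : SpaceTime) (hx : timeDelay r₂ r₀ x = 0) :
    lwDenom r₂ r₀ x = 0 := by
  rw [lwDenom, h.displacement_eq_zero r₀ x hx, hx, inner_zero_left, sub_zero]

/-- Valid also where $T=0$: both sides are then $0$ by the convention for division by zero. -/
theorem uField_mul_zField (r₀ : F) (x : SpaceTime) :
    uField r₂ r₀ x * zField r₂ r₀ x = (lwDenom r₂ r₀ x)⁻¹ := by
  rcases (h.timeDelay_nonneg r₀ x).lt_or_eq with hx | hx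
  · have h1 : eField r₂ r₀ x = (timeDelay r₂ r₀ x)⁻¹ • displacement r₂ r₀ x := by
      rw [eField, one_div, displacement]
    have h2 : lwDenom r₂ r₀ x = timeDelay r₂ r₀ x *
        (1 - inner ℝ (eField r₂ r₀ x) (retardedVelocity r₂ r₀ x)) := by
      rw [h1, real_inner_smul_left, lwDenom]
      field_simp
    rw [h2, mul_inv, uField, zField, one_div, one_div]
  · rw [h.lwDenom_eq_zero r₀ x hx.symm, uField, ← hx]
    simp

theorem hasLineDerivAt_timeDelay (r₀ : F) (d x : SpaceTime) (hx : 0 < timeDelay r₂ r₀ x) :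
    HasLineDerivAt ℝ (timeDelay r₂ r₀) (timeDelayDeriv r₂ r₀ d x) x d := by
  have hline : Continuous fun s : ℝ => ((r₀, x + s • d) : F × SpaceTime) := by fun_prop
  -- The divided difference of the trajectory expresses the increment of the displacement exactly,
  -- and it is continuous at the base point by differentiability.
  have hA0 : dslope (fun t => r₂ t r₀) (retardedTime r₂ r₀ x)
      (retardedTime r₂ r₀ (x + (0 : ℝ) • d)) = retardedVelocity r₂ r₀ x := by
    rw [zero_smul, add_zero, dslope_same, retardedVelocity]
  have key := hasDerivAt_of_eq_norm
    (q := fun s : ℝ => timeDelay r₂ r₀ (x + s • d))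
    (R := fun s : ℝ => displacement r₂ r₀ (x + s • d))
    (A := fun s : ℝ => dslope (fun t => r₂ t r₀) (retardedTime r₂ r₀ x)
      (retardedTime r₂ r₀ (x + s • d))) (d₁ := d.1) (d₂ := d.2)
    (h.continuous_timeDelay.comp hline).continuousAt
    (h.continuous_displacement.comp hline).continuousAt ?_
    (fun s => h.timeDelay_eq_norm r₀ _) (fun s => ?_) ?_
  · simp only [hA0] at key
    simp only [zero_smul, add_zero] at key
    exact key
  · have h1 : Continuous fun s : ℝ => retardedTime r₂ r₀ (x + s • d) :=
      h.continuous_retardedTime.comp hline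
    refine ContinuousAt.comp (f := fun s : ℝ => retardedTime r₂ r₀ (x + s • d)) ?_ h1.continuousAt
    rw [zero_smul, add_zero]
    exact continuousAt_dslope_same.2 (h.hasDerivAt_position r₀ _).differentiableAt
  · have e1 := sub_smul_dslope (fun t => r₂ t r₀) (retardedTime r₂ r₀ x)
      (retardedTime r₂ r₀ (x + s • d))
    have e2 : retardedTime r₂ r₀ (x + s • d) - retardedTime r₂ r₀ x =
        s * d.2 - (timeDelay r₂ r₀ (x + s • d) - timeDelay r₂ r₀ x) := by
      simp only [retardedTime, Prod.snd_add, Prod.smul_snd, smul_eq_mul]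
      ring
    rw [e2] at e1
    simp only [zero_smul, add_zero]
    rw [e1]
    simp only [displacement, Prod.fst_add, Prod.smul_fst]
    abel
  · simp only [hA0]
    simp only [zero_smul, add_zero]
    exact (h.lwDenom_pos r₀ x hx).ne'

theorem one_sub_timeDelayDeriv (r₀ : F) (d x : SpaceTime) (hx : 0 < timeDelay r₂ r₀ x) :
    d.2 - timeDelayDeriv r₂ r₀ d x = retardedTimeDeriv r₂ r₀ d x := by
  have hP := (h.lwDenom_pos r₀ x hx).ne'
  rw [timeDelayDeriv, retardedTimeDeriv, ← div_eq_mul_inv, ← div_eq_mul_inv, eq_div_iff hP,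
    sub_mul, div_mul_cancel₀ _ hP, lwDenom]
  ring

theorem hasLineDerivAt_retardedTime (r₀ : F) (d x : SpaceTime) (hx : 0 < timeDelay r₂ r₀ x) :
    HasLineDerivAt ℝ (retardedTime r₂ r₀) (retardedTimeDeriv r₂ r₀ d x) x d := by
  have h1 : HasDerivAt (fun s : ℝ => timeDelay r₂ r₀ (x + s • d)) _ 0 :=
    h.hasLineDerivAt_timeDelay r₀ d x hx
  have h2 : HasDerivAt (fun s : ℝ => (x + s • d).2) d.2 0 := by
    simpa using ((hasDerivAt_id (0 : ℝ)).mul_const d.2).const_add x.2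
  rw [← h.one_sub_timeDelayDeriv r₀ d x hx]
  exact h2.sub h1

theorem hasLineDerivAt_comp_retardedTime (r₀ : F) (d x : SpaceTime) (hx : 0 < timeDelay r₂ r₀ x)
    {a : ℝ → Space} {a' : Space} (ha : HasDerivAt a a' (retardedTime r₂ r₀ x)) :
    HasLineDerivAt ℝ (fun y => a (retardedTime r₂ r₀ y))
      (retardedTimeDeriv r₂ r₀ d x • a') x d := by
  have h1 : HasDerivAt (fun s : ℝ => retardedTime r₂ r₀ (x + s • d)) _ 0 :=
    h.hasLineDerivAt_retardedTime r₀ d x hx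
  exact HasDerivAt.scomp (0 : ℝ) (by simpa using ha) h1

theorem hasLineDerivAt_displacement (r₀ : F) (d x : SpaceTime) (hx : 0 < timeDelay r₂ r₀ x) :
    HasLineDerivAt ℝ (displacement r₂ r₀) (displacementDeriv r₂ r₀ d x) x d := by
  have h1 : HasDerivAt (fun s : ℝ => r₂ (retardedTime r₂ r₀ (x + s • d)) r₀) _ 0 :=
    h.hasLineDerivAt_comp_retardedTime r₀ d x hx (h.hasDerivAt_position r₀ _)
  have h2 : HasDerivAt (fun s : ℝ => (x + s • d).1) d.1 0 := by
    simpa using ((hasDerivAt_id (0 : ℝ)).smul_const d.1).const_add x.1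
  exact h2.sub h1

theorem hasLineDerivAt_retardedVelocity (r₀ : F) (d x : SpaceTime)
    (hx : 0 < timeDelay r₂ r₀ x) :
    HasLineDerivAt ℝ (retardedVelocity r₂ r₀)
      (retardedTimeDeriv r₂ r₀ d x • retardedAcceleration r₂ r₀ x) x d :=
  h.hasLineDerivAt_comp_retardedTime r₀ d x hx
    ((h.contDiff_velocity r₀).differentiable (by simp) _).hasDerivAt

theorem hasLineDerivAt_lwDenom (r₀ : F) (d x : SpaceTime) (hx : 0 < timeDelay r₂ r₀ x) :
    HasLineDerivAt ℝ (lwDenom r₂ r₀) (lwDenomDeriv r₂ r₀ d x) x d := by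
  have h1 : HasDerivAt (fun s : ℝ => timeDelay r₂ r₀ (x + s • d)) _ 0 :=
    h.hasLineDerivAt_timeDelay r₀ d x hx
  have h2 : HasDerivAt (fun s : ℝ => displacement r₂ r₀ (x + s • d)) _ 0 :=
    h.hasLineDerivAt_displacement r₀ d x hx
  have h3 : HasDerivAt (fun s : ℝ => retardedVelocity r₂ r₀ (x + s • d)) _ 0 :=
    h.hasLineDerivAt_retardedVelocity r₀ d x hx
  have h4 := h1.sub (h2.inner ℝ h3)
  simp only [zero_smul, add_zero] at h4
  exact h4

end IsFlowOfMatter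

end Kinematics

/-! ### Singularities on the world line -/

section SingularOrder

variable {E E' : Type*} [NormedAddCommGroup E] [NormedAddCommGroup E'] {T : SpaceTime → ℝ}

/-- The function `f` is locally bounded by a multiple of `T ^ (-k)`. -/
def SingularOrder (T : SpaceTime → ℝ) (k : ℕ) (f : SpaceTime → E) : Prop :=
  ∀ K : Set SpaceTime, IsCompact K → ∃ C : ℝ, ∀ x ∈ K, ‖f x‖ ≤ C * (T x)⁻¹ ^ k

namespace SingularOrder

theorem of_continuous {f : SpaceTime → E} (hf : Continuous f) : SingularOrder T 0 f := by
  intro K hK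
  obtain ⟨C, hC⟩ := hK.exists_bound_of_continuousOn hf.continuousOn
  exact ⟨C, fun x hx => by simpa using hC x hx⟩

theorem add {f g : SpaceTime → E} {k : ℕ} (hf : SingularOrder T k f) (hg : SingularOrder T k g) :
    SingularOrder T k fun x => f x + g x := by
  intro K hK
  obtain ⟨C, hC⟩ := hf K hK
  obtain ⟨D, hD⟩ := hg K hK
  refine ⟨C + D, fun x hx => (norm_add_le _ _).trans ?_⟩
  rw [add_mul]
  exact add_le_add (hC x hx) (hD x hx)

theorem neg {f : SpaceTime → E} {k : ℕ} (hf : SingularOrder T k f) :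
    SingularOrder T k fun x => -f x := by
  simpa only [SingularOrder, norm_neg] using hf

theorem sub {f g : SpaceTime → E} {k : ℕ} (hf : SingularOrder T k f) (hg : SingularOrder T k g) :
    SingularOrder T k fun x => f x - g x := by
  simpa only [sub_eq_add_neg] using hf.add hg.neg

theorem of_norm_le_mul {f : SpaceTime → E} {f' : SpaceTime → E'}
    {g : SpaceTime → ℝ} {k l : ℕ} (hf : SingularOrder T k f') (hg : SingularOrder T l g)
    (hle : ∀ x, ‖f x‖ ≤ ‖f' x‖ * ‖g x‖) : SingularOrder T (k + l) f := by
  intro K hK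
  obtain ⟨C, hC⟩ := hf K hK
  obtain ⟨D, hD⟩ := hg K hK
  refine ⟨C * D, fun x hx => (hle x).trans ?_⟩
  have := mul_le_mul (hC x hx) (hD x hx) (norm_nonneg _) ((norm_nonneg _).trans (hC x hx))
  rwa [mul_mul_mul_comm, ← pow_add] at this

theorem mul {f g : SpaceTime → ℝ} {k l : ℕ} (hf : SingularOrder T k f)
    (hg : SingularOrder T l g) : SingularOrder T (k + l) fun x => f x * g x :=
  hf.of_norm_le_mul hg fun _ => norm_mul_le _ _

theorem smul [NormedSpace ℝ E] {f : SpaceTime → ℝ} {g : SpaceTime → E}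
    {k l : ℕ} (hf : SingularOrder T k f) (hg : SingularOrder T l g) :
    SingularOrder T (l + k) fun x => f x • g x :=
  hg.of_norm_le_mul hf fun _ => by rw [norm_smul, mul_comm]

theorem inner {f g : SpaceTime → Space} {k l : ℕ} (hf : SingularOrder T k f)
    (hg : SingularOrder T l g) : SingularOrder T (k + l) fun x => inner ℝ (f x) (g x) :=
  hf.of_norm_le_mul (g := fun x => ‖g x‖) (by simpa only [SingularOrder, norm_norm] using hg)
    fun x => by simpa using norm_inner_le_norm (𝕜 := ℝ) (f x) (g x)

theorem apply {f : SpaceTime → Space} {k : ℕ} (hf : SingularOrder T k f) (i : Fin 3) :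
    SingularOrder T k fun x => f x i := by
  intro K hK
  obtain ⟨C, hC⟩ := hf K hK
  exact ⟨C, fun x hx => (PiLp.norm_apply_le (f x) i).trans (hC x hx)⟩

theorem succ_succ (hT : Continuous T) (hT0 : ∀ x, 0 ≤ T x) {f : SpaceTime → E} {k : ℕ}
    (hf : SingularOrder T (k + 1) f) : SingularOrder T (k + 2) f := by
  intro K hK
  obtain ⟨C, hC⟩ := hf K hK
  obtain ⟨D, hD⟩ := hK.exists_bound_of_continuousOn hT.continuousOn
  refine ⟨|C| * D, fun x hx => (hC x hx).trans ?_⟩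
  -- At $T=0$ both sides vanish because the exponents are positive; this is why the order starts at
  -- `k + 1`.
  have e : (T x)⁻¹ ^ (k + 1) = T x * (T x)⁻¹ ^ (k + 2) := by
    rcases eq_or_ne (T x) 0 with h0 | h0
    · simp [h0]
    · rw [pow_succ' _ (k + 1), mul_inv_cancel_left₀ h0]
  have hq : 0 ≤ (T x)⁻¹ ^ (k + 2) := pow_nonneg (inv_nonneg.2 (hT0 x)) _
  rw [e, ← mul_assoc]
  refine mul_le_mul_of_nonneg_right ?_ hq
  exact mul_le_mul (le_abs_self C) ((le_abs_self _).trans (hD x hx)) (hT0 x) (abs_nonneg C)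

end SingularOrder

end SingularOrder

/-! ### Weak derivatives of the Liénard–Wiechert kernels. -/

section Weak

variable {F : Set Space} {t₀ : ℝ} {r₂ : ℝ → F → Space}

namespace IsFlowOfMatter

variable (h : IsFlowOfMatter F t₀ r₂)

include h

theorem continuous_timeDelay_right (r₀ : F) : Continuous (timeDelay r₂ r₀) := by
  simpa only [Function.comp_def] using
    h.continuous_timeDelay.comp (Continuous.prodMk_right r₀)

theorem continuous_displacement_right (r₀ : F) : Continuous (displacement r₂ r₀) := by
  simpa only [Function.comp_def] using
    h.continuous_displacement.comp (Continuous.prodMk_right r₀)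

theorem continuous_retardedVelocity_right (r₀ : F) : Continuous (retardedVelocity r₂ r₀) := by
  simpa only [Function.comp_def] using
    h.continuous_retardedVelocity.comp (Continuous.prodMk_right r₀)

theorem continuous_retardedAcceleration_right (r₀ : F) :
    Continuous (retardedAcceleration r₂ r₀) := by
  simpa only [Function.comp_def] using
    h.continuous_retardedAcceleration.comp (Continuous.prodMk_right r₀)

theorem continuous_lwDenom_right (r₀ : F) : Continuous (lwDenom r₂ r₀) := by
  simpa only [Function.comp_def] using
    h.continuous_lwDenom.comp (Continuous.prodMk_right r₀)

theorem continuous_position_left (r₀ : F) : Continuous fun t => r₂ t r₀ :=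
  h.continuous_position.comp (Continuous.prodMk_left r₀)

theorem ae_timeDelay_pos (r₀ : F) : ∀ᵐ x, 0 < timeDelay r₂ r₀ x := by
  filter_upwards [ae_ne_moving_point (h.continuous_position_left r₀)] with x hx
  have := h.norm_sub_position_le r₀ x
  have := norm_pos_iff.2 hx
  linarith

theorem inv_timeDelay_pow_le (r₀ : F) (x : SpaceTime) (k : ℕ) :
    (timeDelay r₂ r₀ x)⁻¹ ^ k ≤ 2 ^ k * ‖x.1 - r₂ x.2 r₀‖⁻¹ ^ k := by
  rw [← mul_pow]
  have hT := h.timeDelay_nonneg r₀ x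
  refine pow_le_pow_left₀ (inv_nonneg.2 hT) ?_ k
  have h1 := h.norm_sub_position_le r₀ x
  rcases (norm_nonneg (x.1 - r₂ x.2 r₀)).lt_or_eq with h0 | h0
  · have hT' : 0 < timeDelay r₂ r₀ x := by linarith
    rw [← div_eq_mul_inv, le_div_iff₀ h0, inv_mul_le_iff₀ hT']
    linarith
  -- On the world line $T=0$ solves the delay equation, hence is the delay by uniqueness.
  · have : timeDelay r₂ r₀ x = 0 :=
      (h.existsUnique_timeDelay r₀ x).unique (h.timeDelay_eq r₀ x) (by rw [sub_zero]; exact h0)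
    rw [this, ← h0]
    simp

/-- Compactness of $F$ confines all trajectories to one ball over a bounded time interval, which
makes the bound uniform in $r_0$. -/
theorem exists_lintegral_inv_timeDelay_pow_le {k : ℕ} (hk : k ≤ 2) {K : Set SpaceTime}
    (hK : IsCompact K) :
    ∃ C : ℝ≥0∞, C ≠ ⊤ ∧
      ∀ r₀, ∫⁻ x in K, ENNReal.ofReal ((timeDelay r₂ r₀ x)⁻¹ ^ k) ≤ C := by
  obtain ⟨ρ, hρ⟩ := hK.isBounded.subset_closedBall 0
  have : CompactSpace F := isCompact_iff_compactSpace.1 h.isCompact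
  obtain ⟨M, hM⟩ := ((isCompact_closedBall (0 : ℝ) ρ).prod
    (isCompact_univ (X := F))).exists_bound_of_continuousOn h.continuous_position.continuousOn
  obtain ⟨C, hC, hCle⟩ := exists_lintegral_inv_dist_pow_le hk ρ M
  refine ⟨ENNReal.ofReal (2 ^ k) * C, ENNReal.mul_ne_top (by simp) hC, fun r₀ => ?_⟩
  refine le_trans ?_ (mul_le_mul_right (hCle (fun t => r₂ t r₀) (h.continuous_position_left r₀)
    fun t ht => hM (t, r₀) ⟨ht, mem_univ _⟩) _)
  rw [← lintegral_const_mul' _ _ (by simp)]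
  refine (lintegral_mono_set hρ).trans (lintegral_mono fun x => ?_)
  rw [← ENNReal.ofReal_mul (by positivity)]
  exact ENNReal.ofReal_le_ofReal (h.inv_timeDelay_pow_le r₀ x k)

theorem lintegral_enorm_le (r₀ : F) {f : SpaceTime → ℝ} {k : ℕ} {K : Set SpaceTime}
    (hK : IsCompact K) {c : ℝ} {C : ℝ≥0∞}
    (hC : ∫⁻ x in K, ENNReal.ofReal ((timeDelay r₂ r₀ x)⁻¹ ^ k) ≤ C)
    (hf : ∀ x ∈ K, |f x| ≤ c * (timeDelay r₂ r₀ x)⁻¹ ^ k) :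
    ∫⁻ x in K, ‖f x‖ₑ ≤ ENNReal.ofReal c * C := by
  refine le_trans ?_ (mul_le_mul_right hC _)
  rw [← lintegral_const_mul' _ _ (by simp)]
  refine setLIntegral_mono' hK.measurableSet fun x hx => ?_
  have := h.timeDelay_nonneg r₀ x
  rw [← ENNReal.ofReal_mul' (by positivity), Real.enorm_eq_ofReal_abs]
  exact ENNReal.ofReal_le_ofReal (hf x hx)

theorem exists_lintegral_enorm_le {f : F → SpaceTime → ℝ} {k : ℕ} (hk : k ≤ 2) {K : Set SpaceTime}
    (hK : IsCompact K) {c : ℝ}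
    (hf : ∀ r₀, ∀ x ∈ K, |f r₀ x| ≤ c * (timeDelay r₂ r₀ x)⁻¹ ^ k) :
    ∃ C : ℝ≥0∞, C ≠ ⊤ ∧ ∀ r₀, ∫⁻ x in K, ‖f r₀ x‖ₑ ≤ C := by
  obtain ⟨C, hC, hCle⟩ := h.exists_lintegral_inv_timeDelay_pow_le hk hK
  exact ⟨ENNReal.ofReal c * C, ENNReal.mul_ne_top (by simp) hC,
    fun r₀ => h.lintegral_enorm_le r₀ hK (hCle r₀) (hf r₀)⟩

theorem locallyIntegrable_of_singularOrder (r₀ : F) {f : SpaceTime → ℝ} {k : ℕ} (hk : k ≤ 2)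
    (hm : Measurable f) (hf : SingularOrder (timeDelay r₂ r₀) k f) : LocallyIntegrable f := by
  rw [locallyIntegrable_iff]
  intro K hK
  obtain ⟨c, hc⟩ := hf K hK
  obtain ⟨C, hC, hCle⟩ := h.exists_lintegral_inv_timeDelay_pow_le hk hK
  exact ⟨hm.aestronglyMeasurable, (h.lintegral_enorm_le r₀ hK (hCle r₀) hc).trans_lt
    (ENNReal.mul_lt_top (by simp) hC.lt_top)⟩

theorem inv_lwDenom_le {t₁ v₁ : ℝ} (r₀ : F) (hv1 : v₁ < 1)
    (hv : ∀ t ≤ t₁, ‖deriv (fun s => r₂ s r₀) t‖ ≤ v₁) (x : SpaceTime) (hx : x.2 ≤ t₁) :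
    |(lwDenom r₂ r₀ x)⁻¹| ≤ (1 - v₁)⁻¹ * (timeDelay r₂ r₀ x)⁻¹ := by
  have h1 : 0 < 1 - v₁ := by linarith
  rcases (h.timeDelay_nonneg r₀ x).lt_or_eq with h0 | h0
  · rw [abs_of_pos (inv_pos.2 (h.lwDenom_pos r₀ x h0)), ← mul_inv]
    exact inv_anti₀ (mul_pos h1 h0) (h.lwDenom_ge r₀ hv x hx)
  · rw [h.lwDenom_eq_zero r₀ x h0.symm, ← h0]
    simp

theorem exists_inv_lwDenom_le {K : Set SpaceTime} (hK : IsCompact K) :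
    ∃ c : ℝ, 0 ≤ c ∧ ∀ r₀, ∀ x ∈ K, |(lwDenom r₂ r₀ x)⁻¹| ≤ c * (timeDelay r₂ r₀ x)⁻¹ := by
  obtain ⟨t₁, ht₁⟩ := hK.exists_bound_of_continuousOn continuous_snd.continuousOn
  obtain ⟨v₁, hv1, hv⟩ := h.speed_le t₁
  refine ⟨(1 - v₁)⁻¹, inv_nonneg.2 (by linarith), fun r₀ x hx => ?_⟩
  exact h.inv_lwDenom_le r₀ hv1 (fun t ht => hv t ht r₀) x ((le_abs_self _).trans (ht₁ x hx))

theorem singularOrder_inv_lwDenom (r₀ : F) :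
    SingularOrder (timeDelay r₂ r₀) 1 fun x => (lwDenom r₂ r₀ x)⁻¹ := by
  intro K hK
  obtain ⟨c, -, hc⟩ := h.exists_inv_lwDenom_le hK
  exact ⟨c, fun x hx => by simpa using hc r₀ x hx⟩

/-- Since $|R|=T$, the singularity of $1/P$ cancels. This is why the first derivatives of $T$,
$\tau$ and $P$ stay locally bounded. -/
theorem singularOrder_inv_lwDenom_smul_displacement (r₀ : F) :
    SingularOrder (timeDelay r₂ r₀) 0 fun x => (lwDenom r₂ r₀ x)⁻¹ • displacement r₂ r₀ x := by
  intro K hK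
  obtain ⟨c, hc0, hc⟩ := h.exists_inv_lwDenom_le hK
  refine ⟨c, fun x hx => ?_⟩
  rw [norm_smul, ← h.timeDelay_eq_norm, pow_zero, mul_one]
  refine (mul_le_mul_of_nonneg_right (hc r₀ x hx) (h.timeDelay_nonneg r₀ x)).trans ?_
  rw [mul_assoc]
  exact mul_le_of_le_one_right hc0 inv_mul_le_one

theorem singularOrder_timeDelay_mul_inv_lwDenom (r₀ : F) :
    SingularOrder (timeDelay r₂ r₀) 0 fun x => timeDelay r₂ r₀ x * (lwDenom r₂ r₀ x)⁻¹ := by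
  have := h.singularOrder_inv_lwDenom_smul_displacement r₀
  intro K hK
  obtain ⟨c, hc⟩ := this K hK
  refine ⟨c, fun x hx => ?_⟩
  have h1 := hc x hx
  rw [norm_smul, ← h.timeDelay_eq_norm, mul_comm] at h1
  rwa [norm_mul, Real.norm_of_nonneg (h.timeDelay_nonneg r₀ x)]

theorem singularOrder_inv_timeDelay (r₀ : F) :
    SingularOrder (timeDelay r₂ r₀) 1 fun x => (timeDelay r₂ r₀ x)⁻¹ := fun _ _ =>
  ⟨1, fun x _ => by
    rw [Real.norm_of_nonneg (inv_nonneg.2 (h.timeDelay_nonneg r₀ x)), pow_one, one_mul]⟩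

theorem singularOrder_timeDelayDeriv (r₀ : F) (d : SpaceTime) :
    SingularOrder (timeDelay r₂ r₀) 0 (timeDelayDeriv r₂ r₀ d) := by
  have hn := h.singularOrder_inv_lwDenom_smul_displacement r₀
  have h1 := hn.inner (.of_continuous (continuous_const (y := d.1)))
  have h2 := (hn.inner (.of_continuous (h.continuous_retardedVelocity_right r₀))).mul
    (.of_continuous (continuous_const (y := d.2)))
  convert! h1.sub h2 using 2 with x
  rw [timeDelayDeriv, real_inner_smul_left, real_inner_smul_left]
  ring

theorem singularOrder_retardedTimeDeriv (r₀ : F) (d : SpaceTime) :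
    SingularOrder (timeDelay r₂ r₀) 0 (retardedTimeDeriv r₂ r₀ d) := by
  have h1 := (h.singularOrder_inv_lwDenom_smul_displacement r₀).inner
    (.of_continuous (continuous_const (y := d.1)))
  have h2 := (h.singularOrder_timeDelay_mul_inv_lwDenom r₀).mul
    (.of_continuous (continuous_const (y := d.2)))
  convert! h2.sub h1 using 2 with x
  rw [retardedTimeDeriv, real_inner_smul_left]
  ring

theorem singularOrder_lwDenomDeriv (r₀ : F) (d : SpaceTime) :
    SingularOrder (timeDelay r₂ r₀) 0 (lwDenomDeriv r₂ r₀ d) := by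
  have hτ := h.singularOrder_retardedTimeDeriv r₀ d
  have hv := SingularOrder.of_continuous (T := timeDelay r₂ r₀)
    (h.continuous_retardedVelocity_right r₀)
  have hw := SingularOrder.of_continuous (T := timeDelay r₂ r₀)
    (h.continuous_retardedAcceleration_right r₀)
  have hR := SingularOrder.of_continuous (T := timeDelay r₂ r₀)
    (h.continuous_displacement_right r₀)
  have hd := SingularOrder.of_continuous (T := timeDelay r₂ r₀) (continuous_const (y := d.1))
  exact (h.singularOrder_timeDelayDeriv r₀ d).sub
    ((hR.inner (hτ.smul hw)).add ((hd.sub (hτ.smul hv)).inner hv))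

theorem measurable_timeDelayDeriv (r₀ : F) (d : SpaceTime) :
    Measurable (timeDelayDeriv r₂ r₀ d) := by
  have hR := h.continuous_displacement_right r₀
  have hv := h.continuous_retardedVelocity_right r₀
  refine Measurable.mul ?_ (h.continuous_lwDenom_right r₀).measurable.inv
  exact ((hR.inner continuous_const).sub ((hR.inner hv).mul continuous_const)).measurable

theorem measurable_retardedTimeDeriv (r₀ : F) (d : SpaceTime) :
    Measurable (retardedTimeDeriv r₂ r₀ d) := by
  refine Measurable.mul ?_ (h.continuous_lwDenom_right r₀).measurable.inv
  exact (((h.continuous_timeDelay_right r₀).mul continuous_const).sub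
    ((h.continuous_displacement_right r₀).inner continuous_const)).measurable

theorem measurable_lwDenomDeriv (r₀ : F) (d : SpaceTime) :
    Measurable (lwDenomDeriv r₂ r₀ d) := by
  have hτ := h.measurable_retardedTimeDeriv r₀ d
  have hv := (h.continuous_retardedVelocity_right r₀).measurable
  have hw := (h.continuous_retardedAcceleration_right r₀).measurable
  have hR := (h.continuous_displacement_right r₀).measurable
  exact (h.measurable_timeDelayDeriv r₀ d).sub
    ((hR.inner (hτ.smul hw)).add ((measurable_const.sub (hτ.smul hv)).inner hv))

end IsFlowOfMatter

/-- The derivative of the scalar Liénard–Wiechert potential in the direction `d`. -/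
def scalarKernelDeriv (r₂ : ℝ → F → Space) (r₀ : F) (d x : SpaceTime) : ℝ :=
  -lwDenomDeriv r₂ r₀ d x * ((lwDenom r₂ r₀ x)⁻¹ * (lwDenom r₂ r₀ x)⁻¹)

/-- The derivative of the vector Liénard–Wiechert potential in the direction `d`. -/
def vectorKernelDeriv (r₂ : ℝ → F → Space) (r₀ : F) (d x : SpaceTime) : Space :=
  (lwDenom r₂ r₀ x)⁻¹ • (retardedTimeDeriv r₂ r₀ d x • retardedAcceleration r₂ r₀ x)
    + scalarKernelDeriv r₂ r₀ d x • retardedVelocity r₂ r₀ x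

namespace IsFlowOfMatter

variable (h : IsFlowOfMatter F t₀ r₂)

include h

theorem hasLineDerivAt_inv_lwDenom (r₀ : F) (d x : SpaceTime) (hx : 0 < timeDelay r₂ r₀ x) :
    HasLineDerivAt ℝ (fun y => (lwDenom r₂ r₀ y)⁻¹) (scalarKernelDeriv r₂ r₀ d x) x d := by
  have h1 : HasDerivAt (fun s : ℝ => lwDenom r₂ r₀ (x + s • d)) _ 0 :=
    h.hasLineDerivAt_lwDenom r₀ d x hx
  have h2 := h1.inv (by simpa using (h.lwDenom_pos r₀ x hx).ne')
  refine HasDerivAt.congr_deriv h2 ?_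
  rw [scalarKernelDeriv, zero_smul, add_zero, div_eq_mul_inv, sq, mul_inv]

theorem hasLineDerivAt_vectorKernel (r₀ : F) (d x : SpaceTime) (hx : 0 < timeDelay r₂ r₀ x) :
    HasLineDerivAt ℝ (fun y => (lwDenom r₂ r₀ y)⁻¹ • retardedVelocity r₂ r₀ y)
      (vectorKernelDeriv r₂ r₀ d x) x d := by
  have h1 : HasDerivAt (fun s : ℝ => (lwDenom r₂ r₀ (x + s • d))⁻¹) _ 0 :=
    h.hasLineDerivAt_inv_lwDenom r₀ d x hx
  have h2 : HasDerivAt (fun s : ℝ => retardedVelocity r₂ r₀ (x + s • d)) _ 0 :=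
    h.hasLineDerivAt_retardedVelocity r₀ d x hx
  have h3 := h1.smul h2
  simp only [zero_smul, add_zero] at h3
  exact h3

theorem hasLineDerivAt_vectorKernel_apply (r₀ : F) (d x : SpaceTime)
    (hx : 0 < timeDelay r₂ r₀ x) (i : Fin 3) :
    HasLineDerivAt ℝ (fun y => ((lwDenom r₂ r₀ y)⁻¹ • retardedVelocity r₂ r₀ y) i)
      (vectorKernelDeriv r₂ r₀ d x i) x d := by
  have h1 : HasDerivAt (fun s : ℝ => (lwDenom r₂ r₀ (x + s • d))⁻¹ •
      retardedVelocity r₂ r₀ (x + s • d)) _ 0 := h.hasLineDerivAt_vectorKernel r₀ d x hx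
  exact (EuclideanSpace.proj (𝕜 := ℝ) i).hasFDerivAt.comp_hasDerivAt (0 : ℝ) h1

/-- The derivative is $-P'/P^2$ with $P'$ locally bounded. -/
theorem singularOrder_scalarKernelDeriv (r₀ : F) (d : SpaceTime) :
    SingularOrder (timeDelay r₂ r₀) 2 (scalarKernelDeriv r₂ r₀ d) := by
  have hP := h.singularOrder_inv_lwDenom r₀
  exact (h.singularOrder_lwDenomDeriv r₀ d).neg.mul (hP.mul hP)

theorem measurable_scalarKernelDeriv (r₀ : F) (d : SpaceTime) :
    Measurable (scalarKernelDeriv r₂ r₀ d) :=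
  (h.measurable_lwDenomDeriv r₀ d).neg.mul ((h.continuous_lwDenom_right r₀).measurable.inv.mul
    (h.continuous_lwDenom_right r₀).measurable.inv)

theorem singularOrder_vectorKernelDeriv (r₀ : F) (d : SpaceTime) :
    SingularOrder (timeDelay r₂ r₀) 2 (vectorKernelDeriv r₂ r₀ d) := by
  have h1 := (h.singularOrder_inv_lwDenom r₀).smul
    ((h.singularOrder_retardedTimeDeriv r₀ d).smul
      (.of_continuous (h.continuous_retardedAcceleration_right r₀)))
  have h2 := (h.singularOrder_scalarKernelDeriv r₀ d).smul
    (.of_continuous (h.continuous_retardedVelocity_right r₀))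
  -- The acceleration term has order $1$ only and is weakened to order $2$ to match the velocity
  -- term.
  exact (h1.succ_succ (h.continuous_timeDelay_right r₀) (h.timeDelay_nonneg r₀)).add h2

theorem measurable_vectorKernelDeriv (r₀ : F) (d : SpaceTime) :
    Measurable (vectorKernelDeriv r₂ r₀ d) :=
  ((h.continuous_lwDenom_right r₀).measurable.inv.smul
    ((h.measurable_retardedTimeDeriv r₀ d).smul
      (h.continuous_retardedAcceleration_right r₀).measurable)).add
  ((h.measurable_scalarKernelDeriv r₀ d).smul (h.continuous_retardedVelocity_right r₀).measurable)

theorem locallyIntegrable_scalarKernelDeriv (r₀ : F) (d : SpaceTime) :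
    LocallyIntegrable (scalarKernelDeriv r₂ r₀ d) :=
  h.locallyIntegrable_of_singularOrder r₀ le_rfl (h.measurable_scalarKernelDeriv r₀ d)
    (h.singularOrder_scalarKernelDeriv r₀ d)

theorem locallyIntegrable_vectorKernelDeriv (r₀ : F) (d : SpaceTime) (i : Fin 3) :
    LocallyIntegrable fun x => vectorKernelDeriv r₂ r₀ d x i :=
  h.locallyIntegrable_of_singularOrder r₀ le_rfl
    ((EuclideanSpace.proj (𝕜 := ℝ) i).continuous.measurable.comp
      (h.measurable_vectorKernelDeriv r₀ d))
    ((h.singularOrder_vectorKernelDeriv r₀ d).apply i)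

theorem integral_lineDeriv_mul_inv_lwDenom (r₀ : F) (d : SpaceTime)
    (g : 𝓓((⊤ : Opens SpaceTime), ℝ)) :
    ∫ x, (∂_{d} g) x * (lwDenom r₂ r₀ x)⁻¹ = -∫ x, g x * scalarKernelDeriv r₂ r₀ d x := by
  have hT := h.timeDelay_nonneg r₀
  have hP := h.singularOrder_inv_lwDenom r₀
  have hPm := (h.continuous_lwDenom_right r₀).measurable.inv
  refine integral_testFunction_lineDeriv_mul (h.continuous_timeDelay_right r₀)
    (h.ae_timeDelay_pos r₀) hT (h.hasLineDerivAt_timeDelay r₀ d)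
    (h.hasLineDerivAt_inv_lwDenom r₀ d) ?_ (h.locallyIntegrable_scalarKernelDeriv r₀ d) ?_ g
  · exact h.locallyIntegrable_of_singularOrder r₀ one_le_two hPm hP
  -- The factors $1/P$, $\partial T$ and $1/T$ have orders $1$, $0$ and $1$, so the product just
  -- reaches the admissible order $2$.
  · exact h.locallyIntegrable_of_singularOrder r₀ le_rfl
      ((hPm.mul (h.measurable_timeDelayDeriv r₀ d)).mul
        (h.continuous_timeDelay_right r₀).measurable.inv)
      ((hP.mul (h.singularOrder_timeDelayDeriv r₀ d)).mul
        (h.singularOrder_inv_timeDelay r₀))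

theorem integral_lineDeriv_mul_vectorKernel (r₀ : F) (d : SpaceTime) (i : Fin 3)
    (g : 𝓓((⊤ : Opens SpaceTime), ℝ)) :
    ∫ x, (∂_{d} g) x * ((lwDenom r₂ r₀ x)⁻¹ • retardedVelocity r₂ r₀ x) i =
      -∫ x, g x * vectorKernelDeriv r₂ r₀ d x i := by
  have hT := h.timeDelay_nonneg r₀
  have hA := (((h.singularOrder_inv_lwDenom r₀).smul
    (.of_continuous (h.continuous_retardedVelocity_right r₀))).apply i)
  have hAm : Measurable fun x => ((lwDenom r₂ r₀ x)⁻¹ • retardedVelocity r₂ r₀ x) i :=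
    (EuclideanSpace.proj (𝕜 := ℝ) i).continuous.measurable.comp
      ((h.continuous_lwDenom_right r₀).measurable.inv.smul
        (h.continuous_retardedVelocity_right r₀).measurable)
  refine integral_testFunction_lineDeriv_mul (h.continuous_timeDelay_right r₀)
    (h.ae_timeDelay_pos r₀) hT (h.hasLineDerivAt_timeDelay r₀ d)
    (fun x hx => h.hasLineDerivAt_vectorKernel_apply r₀ d x hx i) ?_
    (h.locallyIntegrable_vectorKernelDeriv r₀ d i) ?_ g
  · exact h.locallyIntegrable_of_singularOrder r₀ one_le_two hAm hA
  · exact h.locallyIntegrable_of_singularOrder r₀ le_rfl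
      ((hAm.mul (h.measurable_timeDelayDeriv r₀ d)).mul
        (h.continuous_timeDelay_right r₀).measurable.inv)
      ((hA.mul (h.singularOrder_timeDelayDeriv r₀ d)).mul
        (h.singularOrder_inv_timeDelay r₀))

end IsFlowOfMatter

end Weak

/-! ### Pointwise identities outside of the world line -/

section Pointwise

variable {F : Set Space} {t₀ : ℝ} {r₂ : ℝ → F → Space}

theorem hasDerivAt_time_of_hasLineDerivAt {E : Type*} [NormedAddCommGroup E] [NormedSpace ℝ E]
    {f : SpaceTime → E} {f' : E} {x : SpaceTime}
    (hf : HasLineDerivAt ℝ f f' x ((0, 1) : SpaceTime)) :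
    HasDerivAt (fun s => f (x.1, s)) f' x.2 := by
  have h1 : HasDerivAt (fun s : ℝ => f (x + s • ((0, 1) : SpaceTime))) f' (x.2 - x.2) := by
    rw [sub_self]
    exact hf
  refine (h1.comp_sub_const x.2 x.2).congr_of_eventuallyEq (Eventually.of_forall fun s => ?_)
  have : x + (s - x.2) • ((0, 1) : SpaceTime) = (x.1, s) := by ext1 <;> simp
  simp only [this]

theorem eField_eq (r₀ : F) (x : SpaceTime) :
    eField r₂ r₀ x = (timeDelay r₂ r₀ x)⁻¹ • displacement r₂ r₀ x := by
  rw [eField, one_div, displacement]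

theorem uField_eq (r₀ : F) (x : SpaceTime) : uField r₂ r₀ x = (timeDelay r₂ r₀ x)⁻¹ :=
  one_div _

theorem displacement_eq_smul (r₀ : F) (x : SpaceTime) (hx : 0 < timeDelay r₂ r₀ x) :
    displacement r₂ r₀ x = timeDelay r₂ r₀ x • eField r₂ r₀ x := by
  rw [eField_eq, smul_inv_smul₀ hx.ne']

theorem retardedTimeDeriv_time (r₀ : F) (x : SpaceTime) :
    retardedTimeDeriv r₂ r₀ (0, 1) x = timeDelay r₂ r₀ x * (lwDenom r₂ r₀ x)⁻¹ := by
  simp [retardedTimeDeriv]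

theorem lwDenom_eq (r₀ : F) (x : SpaceTime) (hx : 0 < timeDelay r₂ r₀ x) :
    lwDenom r₂ r₀ x = timeDelay r₂ r₀ x *
      (1 - inner ℝ (eField r₂ r₀ x) (retardedVelocity r₂ r₀ x)) := by
  rw [lwDenom, displacement_eq_smul r₀ x hx, real_inner_smul_left]
  ring

theorem retardedTimeDeriv_space (r₀ : F) (a : Space) (x : SpaceTime)
    (hx : 0 < timeDelay r₂ r₀ x) :
    retardedTimeDeriv r₂ r₀ (a, 0) x =
      -(timeDelay r₂ r₀ x * (lwDenom r₂ r₀ x)⁻¹ * inner ℝ (eField r₂ r₀ x) a) := by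
  rw [retardedTimeDeriv, displacement_eq_smul r₀ x hx, real_inner_smul_left]
  ring

theorem vectorKernelDeriv_time (r₀ : F) (x : SpaceTime) :
    vectorKernelDeriv r₂ r₀ (0, 1) x =
      ((lwDenom r₂ r₀ x)⁻¹ * (timeDelay r₂ r₀ x * (lwDenom r₂ r₀ x)⁻¹)) •
        retardedAcceleration r₂ r₀ x
      + scalarKernelDeriv r₂ r₀ (0, 1) x • retardedVelocity r₂ r₀ x := by
  rw [vectorKernelDeriv, retardedTimeDeriv_time, smul_smul]

/-- The time derivative of `e`. -/
def eFieldDeriv (r₂ : ℝ → F → Space) (r₀ : F) (x : SpaceTime) : Space :=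
  (lwDenom r₂ r₀ x)⁻¹ • (eField r₂ r₀ x - retardedVelocity r₂ r₀ x)
    - (timeDelay r₂ r₀ x)⁻¹ • eField r₂ r₀ x

namespace IsFlowOfMatter

variable (h : IsFlowOfMatter F t₀ r₂)

include h

theorem timeDelayDeriv_time (r₀ : F) (x : SpaceTime) (hx : 0 < timeDelay r₂ r₀ x) :
    timeDelayDeriv r₂ r₀ (0, 1) x = 1 - timeDelay r₂ r₀ x * (lwDenom r₂ r₀ x)⁻¹ := by
  have := h.one_sub_timeDelayDeriv r₀ (0, 1) x hx
  rw [retardedTimeDeriv_time] at this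
  simp only at this
  linarith

theorem lwDenomDeriv_time (r₀ : F) (x : SpaceTime) (hx : 0 < timeDelay r₂ r₀ x) :
    lwDenomDeriv r₂ r₀ (0, 1) x = 1 - timeDelay r₂ r₀ x * (lwDenom r₂ r₀ x)⁻¹ *
      (1 + timeDelay r₂ r₀ x * inner ℝ (eField r₂ r₀ x) (retardedAcceleration r₂ r₀ x)
        - inner ℝ (retardedVelocity r₂ r₀ x) (retardedVelocity r₂ r₀ x)) := by
  rw [lwDenomDeriv, displacementDeriv, h.timeDelayDeriv_time r₀ x hx, retardedTimeDeriv_time,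
    displacement_eq_smul r₀ x hx, real_inner_smul_left, real_inner_smul_right, inner_sub_left,
    real_inner_smul_left, inner_zero_left]
  ring

/-- As a function of $(r_1,t,\tau)$, $P$ has explicit derivatives $-v$ in $r_1$ and $1$ in $t$. The
dependence through $\tau$ is governed by $\nabla\tau=-e\,\partial_t\tau$, so space derivatives
reduce to the time derivative. -/
theorem lwDenomDeriv_space (r₀ : F) (a : Space) (x : SpaceTime)
    (hx : 0 < timeDelay r₂ r₀ x) :
    lwDenomDeriv r₂ r₀ (a, 0) x = inner ℝ (eField r₂ r₀ x) a *
      (1 - lwDenomDeriv r₂ r₀ (0, 1) x) - inner ℝ (retardedVelocity r₂ r₀ x) a := by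
  rw [h.lwDenomDeriv_time r₀ x hx, lwDenomDeriv, displacementDeriv,
    retardedTimeDeriv_space r₀ a x hx, timeDelayDeriv,
    displacement_eq_smul r₀ x hx]
  simp only [real_inner_smul_left, real_inner_smul_right, inner_sub_left,
    real_inner_comm (retardedVelocity r₂ r₀ x) a]
  ring

theorem scalarKernelDeriv_space (r₀ : F) (a : Space) (x : SpaceTime)
    (hx : 0 < timeDelay r₂ r₀ x) :
    scalarKernelDeriv r₂ r₀ (a, 0) x =
      -(scalarKernelDeriv r₂ r₀ (0, 1) x * inner ℝ (eField r₂ r₀ x) a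
        + (lwDenom r₂ r₀ x)⁻¹ * (lwDenom r₂ r₀ x)⁻¹ *
          inner ℝ (eField r₂ r₀ x - retardedVelocity r₂ r₀ x) a) := by
  rw [scalarKernelDeriv, h.lwDenomDeriv_space r₀ a x hx, scalarKernelDeriv, inner_sub_left]
  ring

theorem hasLineDerivAt_inv_timeDelay (r₀ : F) (x : SpaceTime) (hx : 0 < timeDelay r₂ r₀ x) :
    HasLineDerivAt ℝ (fun y => (timeDelay r₂ r₀ y)⁻¹)
      (-(1 - timeDelay r₂ r₀ x * (lwDenom r₂ r₀ x)⁻¹) * (timeDelay r₂ r₀ x)⁻¹ ^ 2) x (0, 1) := by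
  have h1 : HasDerivAt (fun s : ℝ => timeDelay r₂ r₀ (x + s • ((0, 1) : SpaceTime))) _ 0 :=
    h.hasLineDerivAt_timeDelay r₀ (0, 1) x hx
  refine HasDerivAt.congr_deriv (h1.inv (by simpa using hx.ne')) ?_
  rw [h.timeDelayDeriv_time r₀ x hx, zero_smul, add_zero, div_eq_mul_inv, inv_pow]

theorem hasLineDerivAt_eField (r₀ : F) (x : SpaceTime) (hx : 0 < timeDelay r₂ r₀ x) :
    HasLineDerivAt ℝ (eField r₂ r₀) (eFieldDeriv r₂ r₀ x) x (0, 1) := by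
  have h1 : HasDerivAt (fun s : ℝ => (timeDelay r₂ r₀ (x + s • ((0, 1) : SpaceTime)))⁻¹) _ 0 :=
    h.hasLineDerivAt_inv_timeDelay r₀ x hx
  have h2 : HasDerivAt (fun s : ℝ => displacement r₂ r₀ (x + s • ((0, 1) : SpaceTime))) _ 0 :=
    h.hasLineDerivAt_displacement r₀ (0, 1) x hx
  have h3 := h1.smul h2
  have he : eField r₂ r₀ = fun y => (timeDelay r₂ r₀ y)⁻¹ • displacement r₂ r₀ y :=
    funext (eField_eq r₀)
  simp only [zero_smul, add_zero] at h3
  rw [HasLineDerivAt, he]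
  refine h3.congr_deriv ?_
  rw [eFieldDeriv, displacementDeriv, retardedTimeDeriv_time, displacement_eq_smul r₀ x hx]
  have hT := hx.ne'
  ext i
  simp only [PiLp.add_apply, PiLp.sub_apply, PiLp.smul_apply, smul_eq_mul, PiLp.zero_apply]
  field_simp
  ring

theorem hasLineDerivAt_uSqE (r₀ : F) (x : SpaceTime) (hx : 0 < timeDelay r₂ r₀ x) :
    HasLineDerivAt ℝ (uSqE r₂ r₀)
      ((timeDelay r₂ r₀ x)⁻¹ ^ 2 • eFieldDeriv r₂ r₀ x
        + (2 * (timeDelay r₂ r₀ x)⁻¹ * (-(1 - timeDelay r₂ r₀ x * (lwDenom r₂ r₀ x)⁻¹) *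
          (timeDelay r₂ r₀ x)⁻¹ ^ 2)) • eField r₂ r₀ x) x (0, 1) := by
  have h1 : HasDerivAt (fun s : ℝ => (timeDelay r₂ r₀ (x + s • ((0, 1) : SpaceTime)))⁻¹) _ 0 :=
    h.hasLineDerivAt_inv_timeDelay r₀ x hx
  have h2 : HasDerivAt (fun s : ℝ => eField r₂ r₀ (x + s • ((0, 1) : SpaceTime))) _ 0 :=
    h.hasLineDerivAt_eField r₀ x hx
  have h3 := (h1.pow 2).smul h2
  have he : uSqE r₂ r₀ = fun y => (timeDelay r₂ r₀ y)⁻¹ ^ 2 • eField r₂ r₀ y :=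
    funext fun y => by rw [uSqE, uField_eq]
  simp only [zero_smul, add_zero, Pi.pow_apply] at h3
  rw [HasLineDerivAt, he]
  refine h3.congr_deriv ?_
  norm_num

theorem hasLineDerivAt_eFieldDeriv (r₀ : F) (x : SpaceTime) (hx : 0 < timeDelay r₂ r₀ x) :
    HasLineDerivAt ℝ (eFieldDeriv r₂ r₀)
      ((lwDenom r₂ r₀ x)⁻¹ • (eFieldDeriv r₂ r₀ x -
          (timeDelay r₂ r₀ x * (lwDenom r₂ r₀ x)⁻¹) • retardedAcceleration r₂ r₀ x)
        + scalarKernelDeriv r₂ r₀ (0, 1) x • (eField r₂ r₀ x - retardedVelocity r₂ r₀ x)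
        - ((timeDelay r₂ r₀ x)⁻¹ • eFieldDeriv r₂ r₀ x
          + (-(1 - timeDelay r₂ r₀ x * (lwDenom r₂ r₀ x)⁻¹) * (timeDelay r₂ r₀ x)⁻¹ ^ 2) •
            eField r₂ r₀ x)) x (0, 1) := by
  have h1 : HasDerivAt (fun s : ℝ => (timeDelay r₂ r₀ (x + s • ((0, 1) : SpaceTime)))⁻¹) _ 0 :=
    h.hasLineDerivAt_inv_timeDelay r₀ x hx
  have h2 : HasDerivAt (fun s : ℝ => eField r₂ r₀ (x + s • ((0, 1) : SpaceTime))) _ 0 :=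
    h.hasLineDerivAt_eField r₀ x hx
  have h3 : HasDerivAt (fun s : ℝ => (lwDenom r₂ r₀ (x + s • ((0, 1) : SpaceTime)))⁻¹) _ 0 :=
    h.hasLineDerivAt_inv_lwDenom r₀ (0, 1) x hx
  have h4 : HasDerivAt (fun s : ℝ => retardedVelocity r₂ r₀ (x + s • ((0, 1) : SpaceTime))) _ 0 :=
    h.hasLineDerivAt_retardedVelocity r₀ (0, 1) x hx
  have h5 := (h3.smul (h2.sub h4)).sub (h1.smul h2)
  rw [retardedTimeDeriv_time] at h5
  simp only [zero_smul, add_zero, Pi.sub_apply] at h5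
  exact h5

theorem hasDerivAt_timeDeriv_eField (r₀ : F) (x : SpaceTime) (hx : 0 < timeDelay r₂ r₀ x) :
    HasDerivAt (fun s => timeDeriv (eField r₂ r₀) (x.1, s))
      ((lwDenom r₂ r₀ x)⁻¹ • (eFieldDeriv r₂ r₀ x -
          (timeDelay r₂ r₀ x * (lwDenom r₂ r₀ x)⁻¹) • retardedAcceleration r₂ r₀ x)
        + scalarKernelDeriv r₂ r₀ (0, 1) x • (eField r₂ r₀ x - retardedVelocity r₂ r₀ x)
        - ((timeDelay r₂ r₀ x)⁻¹ • eFieldDeriv r₂ r₀ x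
          + (-(1 - timeDelay r₂ r₀ x * (lwDenom r₂ r₀ x)⁻¹) * (timeDelay r₂ r₀ x)⁻¹ ^ 2) •
            eField r₂ r₀ x)) x.2 := by
  refine (hasDerivAt_time_of_hasLineDerivAt
    (h.hasLineDerivAt_eFieldDeriv r₀ x hx)).congr_of_eventuallyEq ?_
  -- The condition $T>0$ is open in time, so the explicit formula for $\partial_te$ holds near `x.2`
  -- and can be differentiated again.
  have hc : Continuous fun s : ℝ => timeDelay r₂ r₀ (x.1, s) :=
    (h.continuous_timeDelay_right r₀).comp (Continuous.prodMk_right x.1)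
  filter_upwards [hc.continuousAt.eventually_const_lt (show 0 < timeDelay r₂ r₀ (x.1, x.2) from hx)]
    with s hs
  exact (hasDerivAt_time_of_hasLineDerivAt (h.hasLineDerivAt_eField r₀ (x.1, s) hs)).deriv

/-- All explicit negative powers of $T$ cancel, leaving the Liénard–Wiechert form from which the
potentials' derivatives can be recognised. -/
theorem feynmanField_eq (r₀ : F) (x : SpaceTime) (hx : 0 < timeDelay r₂ r₀ x) :
    feynmanField r₂ r₀ x =
      (scalarKernelDeriv r₂ r₀ (0, 1) x + (lwDenom r₂ r₀ x)⁻¹ * (lwDenom r₂ r₀ x)⁻¹) •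
        (eField r₂ r₀ x - retardedVelocity r₂ r₀ x)
      - ((lwDenom r₂ r₀ x)⁻¹ * (timeDelay r₂ r₀ x * (lwDenom r₂ r₀ x)⁻¹)) •
        retardedAcceleration r₂ r₀ x := by
  have h1 : timeDeriv (uSqE r₂ r₀) x = _ :=
    (hasDerivAt_time_of_hasLineDerivAt (h.hasLineDerivAt_uSqE r₀ x hx)).deriv
  have h2 : timeDeriv (timeDeriv (eField r₂ r₀)) x = _ :=
    (h.hasDerivAt_timeDeriv_eField r₀ x hx).deriv
  rw [feynmanField, h1, h2, uSqE, uField_eq, eFieldDeriv]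
  have hT := hx.ne'
  -- The cancellation does not use the relation between $P$ and $T$, so $1/P$ may be treated as a
  -- free variable.
  generalize (lwDenom r₂ r₀ x)⁻¹ = q
  ext i
  simp only [PiLp.add_apply, PiLp.sub_apply, PiLp.smul_apply, smul_eq_mul]
  field_simp
  ring

theorem scalarKernelDeriv_single (r₀ : F) (x : SpaceTime) (hx : 0 < timeDelay r₂ r₀ x)
    (i : Fin 3) :
    scalarKernelDeriv r₂ r₀ (EuclideanSpace.single i 1, 0) x =
      -(scalarKernelDeriv r₂ r₀ (0, 1) x * eField r₂ r₀ x i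
        + (lwDenom r₂ r₀ x)⁻¹ * (lwDenom r₂ r₀ x)⁻¹ *
          (eField r₂ r₀ x i - retardedVelocity r₂ r₀ x i)) := by
  rw [h.scalarKernelDeriv_space r₀ _ x hx]
  simp [EuclideanSpace.inner_single_right]

theorem vectorKernelDeriv_single (r₀ : F) (x : SpaceTime) (hx : 0 < timeDelay r₂ r₀ x)
    (i j : Fin 3) :
    vectorKernelDeriv r₂ r₀ (EuclideanSpace.single i 1, 0) x j =
      -((lwDenom r₂ r₀ x)⁻¹ * (timeDelay r₂ r₀ x * (lwDenom r₂ r₀ x)⁻¹) *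
        eField r₂ r₀ x i * retardedAcceleration r₂ r₀ x j)
      - (scalarKernelDeriv r₂ r₀ (0, 1) x * eField r₂ r₀ x i
        + (lwDenom r₂ r₀ x)⁻¹ * (lwDenom r₂ r₀ x)⁻¹ *
          (eField r₂ r₀ x i - retardedVelocity r₂ r₀ x i)) * retardedVelocity r₂ r₀ x j := by
  rw [vectorKernelDeriv, retardedTimeDeriv_space r₀ _ x hx, h.scalarKernelDeriv_single r₀ x hx]
  simp only [PiLp.add_apply, PiLp.smul_apply, smul_eq_mul, EuclideanSpace.inner_single_right]
  simp
  ring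

theorem electric_kernel (r₀ : F) (x : SpaceTime) (hx : 0 < timeDelay r₂ r₀ x) (i : Fin 3) :
    -scalarKernelDeriv r₂ r₀ (EuclideanSpace.single i 1, 0) x
      - vectorKernelDeriv r₂ r₀ (0, 1) x i = feynmanField r₂ r₀ x i := by
  rw [h.scalarKernelDeriv_single r₀ x hx, vectorKernelDeriv_time, h.feynmanField_eq r₀ x hx]
  simp only [PiLp.add_apply, PiLp.sub_apply, PiLp.smul_apply, smul_eq_mul]
  ring

/-- The vector products agree because $e\times e=v\times v=0$, so $(e-v)\times v=e\times
v=-e\times(e-v)$. Indices are cyclic modulo $3$. -/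
theorem magnetic_kernel (r₀ : F) (x : SpaceTime) (hx : 0 < timeDelay r₂ r₀ x) (i : Fin 3) :
    vectorKernelDeriv r₂ r₀ (EuclideanSpace.single (i + 1) 1, 0) x (i + 2)
      - vectorKernelDeriv r₂ r₀ (EuclideanSpace.single (i + 2) 1, 0) x (i + 1) =
    cross (eField r₂ r₀ x) (feynmanField r₂ r₀ x) i := by
  have hc : ∀ a b : Space, cross a b i = a (i + 1) * b (i + 2) - a (i + 2) * b (i + 1) := by
    intro a b
    fin_cases i <;> simp [cross, cross_apply]
  rw [hc, h.vectorKernelDeriv_single r₀ x hx, h.vectorKernelDeriv_single r₀ x hx,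
    h.feynmanField_eq r₀ x hx]
  simp only [PiLp.sub_apply, PiLp.smul_apply, smul_eq_mul]
  ring

theorem lorenz_kernel (r₀ : F) (x : SpaceTime) (hx : 0 < timeDelay r₂ r₀ x) :
    vectorKernelDeriv r₂ r₀ (EuclideanSpace.single 0 1, 0) x 0
      + vectorKernelDeriv r₂ r₀ (EuclideanSpace.single 1 1, 0) x 1
      + vectorKernelDeriv r₂ r₀ (EuclideanSpace.single 2 1, 0) x 2
      + scalarKernelDeriv r₂ r₀ (0, 1) x = 0 := by
  have hP := (h.lwDenom_pos r₀ x hx).ne'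
  have hq : timeDelay r₂ r₀ x * (lwDenom r₂ r₀ x)⁻¹ *
      (1 - inner ℝ (eField r₂ r₀ x) (retardedVelocity r₂ r₀ x)) = 1 := by
    rw [mul_right_comm, ← lwDenom_eq r₀ x hx, mul_inv_cancel₀ hP]
  simp only [h.vectorKernelDeriv_single r₀ x hx]
  rw [scalarKernelDeriv, h.lwDenomDeriv_time r₀ x hx]
  simp only [PiLp.inner_apply, Fin.sum_univ_three, RCLike.inner_apply, conj_trivial] at hq ⊢
  generalize (lwDenom r₂ r₀ x)⁻¹ = q at *
  generalize timeDelay r₂ r₀ x = T at *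
  generalize eField r₂ r₀ x = e at *
  generalize retardedVelocity r₂ r₀ x = v at *
  generalize retardedAcceleration r₂ r₀ x = w at *
  -- Everything rests on $(T/P)(1-\langle e,v\rangle)=1$; its multiplier is $P^{-2}$ times the
  -- bracket $1+T\langle e,w\rangle-|v|^2$ from $\partial_tP$.
  linear_combination (q * q * (1 + T * (w 0 * e 0 + w 1 * e 1 + w 2 * e 2) -
    (v 0 * v 0 + v 1 * v 1 + v 2 * v 2))) * hq

end IsFlowOfMatter

end Pointwise

/-! ### Calculus of charge integrals -/

section ChargeIntegral

variable {F : Set Space} {q : SignedMeasure F} {f f' : F → SpaceTime → ℝ}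
  {H H' : ScalarDistribution}

namespace IsChargeIntegral

theorem add (hf : IsChargeIntegral q f H) (hf' : IsChargeIntegral q f' H') :
    IsChargeIntegral q (fun r₀ x => f r₀ x + f' r₀ x) (H + H') := by
  refine ⟨fun r₀ => (hf.1 r₀).add (hf'.1 r₀), fun g => ?_⟩
  have e : (fun r₀ => ∫ x, g x * (f r₀ x + f' r₀ x)) =
      fun r₀ => (∫ x, g x * f r₀ x) + ∫ x, g x * f' r₀ x := by
    ext r₀
    rw [← integral_add (integrable_testFunction_mul (hf.1 r₀) g)
      (integrable_testFunction_mul (hf'.1 r₀) g)]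
    simp only [mul_add]
  rw [e]
  refine ⟨(hf.2 g).1.add (hf'.2 g).1, ?_⟩
  rw [VectorMeasure.integral_fun_add (hf.2 g).1 (hf'.2 g).1, ← (hf.2 g).2, ← (hf'.2 g).2]
  rfl

theorem neg (hf : IsChargeIntegral q f H) : IsChargeIntegral q (fun r₀ x => -f r₀ x) (-H) := by
  refine ⟨fun r₀ => (hf.1 r₀).neg, fun g => ?_⟩
  simp only [mul_neg, integral_neg]
  refine ⟨(hf.2 g).1.neg, ?_⟩
  rw [VectorMeasure.integral_fun_neg, ← (hf.2 g).2]
  rfl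

theorem sub (hf : IsChargeIntegral q f H) (hf' : IsChargeIntegral q f' H') :
    IsChargeIntegral q (fun r₀ x => f r₀ x - f' r₀ x) (H - H') := by
  simpa only [sub_eq_add_neg] using hf.add hf'.neg

theorem congr_ae (hf : IsChargeIntegral q f H) (hff' : ∀ r₀, ∀ᵐ x, f r₀ x = f' r₀ x) :
    IsChargeIntegral q f' H := by
  refine ⟨fun r₀ => (hf.1 r₀).congr (hff' r₀), fun g => ?_⟩
  have e : (fun r₀ => ∫ x, g x * f' r₀ x) = fun r₀ => ∫ x, g x * f r₀ x := by
    ext r₀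
    refine integral_congr_ae ?_
    filter_upwards [hff' r₀] with x hx
    rw [hx]
  rw [e]
  exact hf.2 g

/-- The pairing of `f'` with `g` is minus the pairing of `f` with the derivative of `g`.
Integrability in $r_0$ is thus inherited from `f`, with no uniform bound on `f'`. -/
theorem lineDerivOp (hf : IsChargeIntegral q f H) {d : SpaceTime}
    (hf' : ∀ r₀, LocallyIntegrable (f' r₀))
    (hd : ∀ r₀ (g : 𝓓((⊤ : Opens SpaceTime), ℝ)),
      ∫ x, (∂_{d} g) x * f r₀ x = -∫ x, g x * f' r₀ x) :
    IsChargeIntegral q f' (∂_{d} H) := by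
  refine ⟨hf', fun g => ?_⟩
  have e : (fun r₀ => ∫ x, g x * f' r₀ x) = fun r₀ => -∫ x, (∂_{d} g) x * f r₀ x := by
    ext r₀
    rw [hd, neg_neg]
  rw [e]
  refine ⟨(hf.2 _).1.neg, ?_⟩
  rw [VectorMeasure.integral_fun_neg, ← (hf.2 _).2, Distribution.lineDerivOp_apply_apply, map_neg]

theorem eq_zero (hf : IsChargeIntegral q f H) (h0 : ∀ r₀, ∀ᵐ x, f r₀ x = 0) : H = 0 := by
  ext g
  rw [((hf.congr_ae (f' := fun _ _ => 0) h0).2 g).2]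
  simp

end IsChargeIntegral

end ChargeIntegral

/-! ### Existence of the potentials, the Lorenz gauge and the field formulas. -/

section Potentials

variable {F : Set Space} {t₀ : ℝ} {r₂ : ℝ → F → Space} {q : SignedMeasure F}
  {φ : ScalarDistribution} {A : VectorDistribution}

namespace IsFlowOfMatter

variable (h : IsFlowOfMatter F t₀ r₂)

include h

theorem exists_isScalarPotential (q : SignedMeasure F) : ∃ φ, IsScalarPotential r₂ q φ := by
  simp only [IsScalarPotential, h.uField_mul_zField]
  refine exists_isChargeIntegral q h.continuous_lwDenom.measurable.inv fun K hK => ?_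
  obtain ⟨c, -, hc⟩ := h.exists_inv_lwDenom_le hK
  exact h.exists_lintegral_enorm_le one_le_two hK (c := c) (by simpa using hc)

theorem exists_isVectorPotential (q : SignedMeasure F) : ∃ A, IsVectorPotential r₂ q A := by
  have key : ∀ i : Fin 3, ∃ Ai, IsChargeIntegral q
      (fun r₀ x => ((uField r₂ r₀ x * zField r₂ r₀ x) • retardedVelocity r₂ r₀ x) i) Ai := by
    intro i
    simp only [h.uField_mul_zField]
    refine exists_isChargeIntegral q ((EuclideanSpace.proj (𝕜 := ℝ) i).continuous.measurable.comp
      (h.continuous_lwDenom.measurable.inv.smul h.continuous_retardedVelocity.measurable))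
      fun K hK => ?_
    obtain ⟨c, hc0, hc⟩ := h.exists_inv_lwDenom_le hK
    obtain ⟨t₁, ht₁⟩ := hK.exists_bound_of_continuousOn continuous_snd.continuousOn
    obtain ⟨v₁, hv1, hv⟩ := h.speed_le t₁
    refine h.exists_lintegral_enorm_le one_le_two hK (c := c) fun r₀ x hx => ?_
    -- Speeds below that of light let the vector kernel inherit the bound of the scalar one.
    have h1 : |retardedVelocity r₂ r₀ x i| ≤ 1 :=
      (PiLp.norm_apply_le _ i).trans ((hv _ ((h.retardedTime_le r₀ x).trans
        ((le_abs_self _).trans (ht₁ x hx))) r₀).trans hv1.le)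
    rw [PiLp.smul_apply, smul_eq_mul, abs_mul, pow_one]
    exact (mul_le_of_le_one_right (abs_nonneg _) h1).trans (hc r₀ x hx)
  choose A hA using key
  exact ⟨A, hA⟩

theorem isChargeIntegral_lineDerivOp_scalarPotential (hφ : IsScalarPotential r₂ q φ)
    (d : SpaceTime) :
    IsChargeIntegral q (fun r₀ => scalarKernelDeriv r₂ r₀ d) (∂_{d} φ) := by
  simp only [IsScalarPotential, h.uField_mul_zField] at hφ
  exact hφ.lineDerivOp (fun r₀ => h.locallyIntegrable_scalarKernelDeriv r₀ d)
    fun r₀ g => h.integral_lineDeriv_mul_inv_lwDenom r₀ d g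

theorem isChargeIntegral_lineDerivOp_vectorPotential (hA : IsVectorPotential r₂ q A)
    (d : SpaceTime) (i : Fin 3) :
    IsChargeIntegral q (fun r₀ x => vectorKernelDeriv r₂ r₀ d x i) (∂_{d} (A i)) := by
  have hAi := hA i
  simp only [h.uField_mul_zField] at hAi
  exact hAi.lineDerivOp (fun r₀ => h.locallyIntegrable_vectorKernelDeriv r₀ d i)
    fun r₀ g => h.integral_lineDeriv_mul_vectorKernel r₀ d i g

theorem lorenz_gauge (hφ : IsScalarPotential r₂ q φ) (hA : IsVectorPotential r₂ q A) :
    divergence A + dTime φ = 0 := by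
  have key := (((h.isChargeIntegral_lineDerivOp_vectorPotential hA
    (EuclideanSpace.single 0 1, 0) 0).add (h.isChargeIntegral_lineDerivOp_vectorPotential hA
    (EuclideanSpace.single 1 1, 0) 1)).add (h.isChargeIntegral_lineDerivOp_vectorPotential hA
    (EuclideanSpace.single 2 1, 0) 2)).add
    (h.isChargeIntegral_lineDerivOp_scalarPotential hφ (0, 1))
  refine key.eq_zero fun r₀ => ?_
  filter_upwards [h.ae_timeDelay_pos r₀] with x hx
  exact h.lorenz_kernel r₀ x hx

theorem isChargeIntegralVec_electric (hφ : IsScalarPotential r₂ q φ)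
    (hA : IsVectorPotential r₂ q A) :
    IsChargeIntegralVec q (fun r₀ x => feynmanField r₂ r₀ x) (-grad φ - dTimeVec A) := by
  intro i
  refine ((h.isChargeIntegral_lineDerivOp_scalarPotential hφ
    (EuclideanSpace.single i 1, 0)).neg.sub
    (h.isChargeIntegral_lineDerivOp_vectorPotential hA (0, 1) i)).congr_ae fun r₀ => ?_
  filter_upwards [h.ae_timeDelay_pos r₀] with x hx
  exact h.electric_kernel r₀ x hx i

theorem isChargeIntegralVec_magnetic (hA : IsVectorPotential r₂ q A) :
    IsChargeIntegralVec q (fun r₀ x => cross (eField r₂ r₀ x) (feynmanField r₂ r₀ x))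
      (curl A) := by
  intro i
  have hi : curl A i = dSpace (i + 1) (A (i + 2)) - dSpace (i + 2) (A (i + 1)) := by
    fin_cases i <;> rfl
  rw [hi]
  refine ((h.isChargeIntegral_lineDerivOp_vectorPotential hA
    (EuclideanSpace.single (i + 1) 1, 0) (i + 2)).sub
    (h.isChargeIntegral_lineDerivOp_vectorPotential hA
      (EuclideanSpace.single (i + 2) 1, 0) (i + 1))).congr_ae fun r₀ => ?_
  filter_upwards [h.ae_timeDelay_pos r₀] with x hx
  exact h.magnetic_kernel r₀ x hx i

end IsFlowOfMatter

end Potentials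

end MatterFlow

end

theorem mainTheorem1 (F : Set Space) (t₀ : ℝ) (r₂ : ℝ → F → Space)
    (hflow : IsFlowOfMatter F t₀ r₂) (q : SignedMeasure F) :
    -- the time derivatives in the integrands exist in the classical sense where `T > 0`
    (∀ (r₀ : F) (x : SpaceTime), 0 < timeDelay r₂ r₀ x →
      DifferentiableAt ℝ (fun s => uSqE r₂ r₀ (x.1, s)) x.2 ∧
      DifferentiableAt ℝ (fun s => eField r₂ r₀ (x.1, s)) x.2 ∧
      DifferentiableAt ℝ (fun s => timeDeriv (eField r₂ r₀) (x.1, s)) x.2) ∧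
    -- the potentials are well-defined generalized functions
    ∃ (φ : ScalarDistribution) (A : VectorDistribution),
      IsScalarPotential r₂ q φ ∧ IsVectorPotential r₂ q A ∧
      ∀ (S : ScalarDistribution) (J E B : VectorDistribution),
        S = -box φ → J = -boxVec A → E = -grad φ - dTimeVec A → B = curl A →
        -- Maxwell's equations
        divergence E = S ∧
        curl E = -dTimeVec B ∧
        divergence B = 0 ∧
        curl B = dTimeVec E + J ∧
        -- integral representations of the fields
        IsChargeIntegralVec q (fun r₀ x => feynmanField r₂ r₀ x) E ∧
        IsChargeIntegralVec q (fun r₀ x => cross (eField r₂ r₀ x) (feynmanField r₂ r₀ x)) B ∧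
        -- equation of continuity
        divergence J + dTime S = 0 := by
  refine ⟨fun r₀ x hx => ⟨?_, ?_, ?_⟩, ?_⟩
  · exact (hasDerivAt_time_of_hasLineDerivAt (hflow.hasLineDerivAt_uSqE r₀ x hx)).differentiableAt
  · exact (hasDerivAt_time_of_hasLineDerivAt (hflow.hasLineDerivAt_eField r₀ x hx)).differentiableAt
  · exact (hflow.hasDerivAt_timeDeriv_eField r₀ x hx).differentiableAt
  obtain ⟨φ, hφ⟩ := hflow.exists_isScalarPotential q
  obtain ⟨A, hA⟩ := hflow.exists_isVectorPotential q
  have hL := hflow.lorenz_gauge hφ hA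
  refine ⟨φ, A, hφ, hA, ?_⟩
  rintro S J E B rfl rfl rfl rfl
  exact ⟨divergence_electric hL, curl_electric, divergence_curl, curl_curl hL,
    hflow.isChargeIntegralVec_electric hφ hA, hflow.isChargeIntegralVec_magnetic hA,
    continuity_equation hL⟩
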